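/- Let $\mathbb{R}^{2,1}$ be $\mathbb{R}^3$ with the Lorentzian form $B(x,y)=x_1y_1+x_2y_2-x_3y_3$, and let $\mathbb{S}_+$ be the disk of directions of positive time-like vectors, i.e. the Beltrami–Klein model of the hyperbolic plane, on which $\mathrm{SO}(2,1)^o$ acts. Let $\Gamma$ be a group of affine isometries $g(x)=\mathcal{L}(g)x+\mathbf{b}_g$ of $\mathbb{R}^{2,1}$ acting freely and properly discontinuously on $\mathbb{R}^{2,1}$, whose group of linear parts $\Gamma_0=\mathcal{L}(\Gamma)\subset \mathrm{SO}(2,1)^o$ is free of finite rank $\ge 2$ and acts freely and properly discontinuously on $\mathbb{S}_+$; put $\mathbf{S}=\mathbb{S}_+/\Gamma_0$. Let $E\subset \mathbf{S}$ be a union of mutually disjoint open cusp neighborhoods, one for each cusp of $\mathbf{S}$, whose inverse image $\mathbb{H}\subset\mathbb{S}_+$ is a union of mutually disjoint open horodisks centered at the parabolic fixed points. Let $\eta$ be a smooth closed $1$-form on $\mathbf{S}$ with values in the flat bundle $(\mathbb{S}_+\times\mathbb{R}^{2,1})/\Gamma_0$ that represents the class of the cocycle $g\mapsto \mathbf{b}_g$,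 i.e. its lift to $\mathbb{S}_+$ is $ds$ for a map $s:\mathbb{S}_+\to\mathbb{R}^{2,1}$ with $s(\mathcal{L}(g)p)=g(s(p))$ for all $g\in\Gamma$, $p\in\mathbb{S}_+$. Assume that on each component of $\mathbb{H}$ the lift of $\eta$ is a standard cusp $1$-form $\mathbf{p}\,dx$, where $\mathbf{p}$ is a (possibly zero) multiple of a null vector in the direction of the center of the horodisk and $x$ is the horizontal coordinate of an upper half-plane model $\{(x,y): y>0\}$ of $\mathbb{S}_+$ in which the horodisk is $\{y>1\}$. Let $\hat K$ be a compact subset of $\mathbb{S}_+\setminus\mathbb{H}$, and let $\Gamma_{\hat K}$ be the set of $g\in\Gamma$ with hyperbolic linear part that act on a geodesic of $\mathbb{S}_+$ meeting $\hat K$. Then there is a bounded set $K\subset\mathbb{R}^{2,1}$ such that every $g\in\Gamma_{\hat K}$ acts on a space-like geodesic $\hat l_g$ of $\mathbb{R}^{2,1}$ (an affine line with space-like direction, $g(\hat l_g)=\hat l_g$) which meets $K$, and the Euclidean diameter of $K$ is less than a constant $C$ that depends only on $\hat K$, $E$ (as a subset of $\mathbf{S}=\mathbb{S}_+/\Gamma_0$)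 and the restriction of $\eta$ to $\mathbf{S}\setminus E$. -/

import Mathlib

open scoped ContDiff

namespace Margulis

noncomputable section

/-- The Lorentzian space `ℝ^{2,1}`. The ambient metric on this type is the Euclidean metric obtained
by changing the sign of the time coordinate. -/
abbrev R21 : Type := EuclideanSpace ℝ (Fin 3)

/-- The affine plane containing the Klein disk. -/
abbrev Plane : Type := EuclideanSpace ℝ (Fin 2)

/-- The Lorentzian inner product `x₁y₁ + x₂y₂ - x₃y₃`. -/
def B (x y : R21) : ℝ := x 0 * y 0 + x 1 * y 1 - x 2 * y 2

/-- Time-like vectors of the positive cone. -/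
def FutureTimelike (v : R21) : Prop := B v v < 0 ∧ 0 < v 2

/-- Nonzero null vectors in the boundary of the positive cone. -/
def FutureNull (v : R21) : Prop := B v v = 0 ∧ 0 < v 2

/-- Membership in `SO(2,1)ᵒ`: the orientation-preserving linear isometries of `ℝ^{2,1}` that preserve
the positive cone. -/
def IsSO21o (A : R21 ≃ₗ[ℝ] R21) : Prop :=
  (∀ x y, B (A x) (A y) = B x y) ∧
  LinearMap.det (A : R21 →ₗ[ℝ] R21) = 1 ∧
  ∀ v, FutureTimelike v → FutureTimelike (A v)

/-- The disk `S₊` of directions of positive time-like vectors (Beltrami-Klein model): the point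
`p` of the open unit disk stands for the direction of `(p₁, p₂, 1)`. -/
def SPlus : Set Plane := Metric.ball 0 1

/-- The representative `(p₁, p₂, 1)` of the direction `p`. -/
def lift (p : Plane) : R21 := !₂[p 0, p 1, 1]

/-- The (projective) action of a linear map on directions. -/
def act (A : R21 ≃ₗ[ℝ] R21) (p : Plane) : Plane :=
  !₂[A (lift p) 0 / A (lift p) 2, A (lift p) 1 / A (lift p) 2]

/-- Complete geodesics of `S₊`: open chords between two points of the boundary circle. -/
def IsGeodesic (l : Set Plane) : Prop :=
  ∃ a ∈ Metric.sphere (0 : Plane) 1, ∃ b ∈ Metric.sphere (0 : Plane) 1,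
    a ≠ b ∧ l = openSegment ℝ a b

/-- An element of `SO(2,1)ᵒ` is hyperbolic if its largest eigenvalue is `> 1`. -/
def IsHyperbolic (A : R21 ≃ₗ[ℝ] R21) : Prop :=
  ∃ c : ℝ, 1 < c ∧ Module.End.HasEigenvalue (A : Module.End ℝ R21) c

/-- The open horodisk attached to a future null vector `n`, centred at the direction of `n`. Every
open horodisk of `S₊` is attached to exactly one future null vector. In the upper half-plane
model in which it is centred at `∞`, `y = √(-B(v,v)) / (-B(n,v))`, so that it is `{y > 1}`. -/
def horodisk (n : R21) : Set Plane :=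
  {p ∈ SPlus | - B n (lift p) < Real.sqrt (- B (lift p) (lift p))}

/-- The horizontal coordinate `x` of an upper half-plane model of `S₊` in which
`horodisk n` is `{y > 1}`; here `m` is a unit space-like vector orthogonal to `n`, and another
choice of `m` replaces `x` by `± x + const`. -/
def cuspCoord (n m : R21) (p : Plane) : ℝ := - B m (lift p) / B n (lift p)

/-- A discrete free subgroup of `SO(2,1)ᵒ` of finite rank at least two, acting freely and
properly discontinuously on the hyperbolic plane `S₊`. -/
structure IsFreeFuchsian (Γ₀ : Subgroup (R21 ≃ₗ[ℝ] R21)) : Prop where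
  so : ∀ A ∈ Γ₀, IsSO21o A
  free_group : ∃ k : ℕ, 2 ≤ k ∧ Nonempty (FreeGroup (Fin k) ≃* Γ₀)
  free_action : ∀ A ∈ Γ₀, ∀ p ∈ SPlus, act A p = p → A = 1
  properly_discontinuous : ∀ Q : Set Plane, IsCompact Q → Q ⊆ SPlus →
    {A | A ∈ Γ₀ ∧ (act A '' Q ∩ Q).Nonempty}.Finite

/-- `Γ` is a group of affine isometries of `ℝ^{2,1}` acting freely and properly discontinuously,
whose group of linear parts is the free Fuchsian group `Γ₀`. -/
structure IsProperAffineHyperbolic (Γ₀ : Subgroup (R21 ≃ₗ[ℝ] R21))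
    (Γ : Subgroup (R21 ≃ᵃ[ℝ] R21)) : Prop where
  fuchsian : IsFreeFuchsian Γ₀
  linear_part : Γ.map (AffineEquiv.linearHom : (R21 ≃ᵃ[ℝ] R21) →* (R21 ≃ₗ[ℝ] R21)) = Γ₀
  free_action : ∀ g ∈ Γ, ∀ x : R21, g x = x → g = 1
  properly_discontinuous : ∀ Q : Set R21, IsCompact Q →
    {g : R21 ≃ᵃ[ℝ] R21 | g ∈ Γ ∧ (g '' Q ∩ Q).Nonempty}.Finite

/-- A union `E` of disjoint open cusp neighbourhoods of `S₊/Γ₀`, one for each cusp. It is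
given by the set `N` of the null vectors of the horodisks covering it: these horodisks are centred at
parabolic fixed points, are mutually disjoint, are permuted by `Γ₀`, and every parabolic fixed point
is the centre of one of them. (An element `A ≠ 1` of `SO(2,1)ᵒ` is parabolic if and only if
it fixes a future null vector.) -/
structure IsCuspFamily (Γ₀ : Subgroup (R21 ≃ₗ[ℝ] R21)) (N : Set R21) : Prop where
  null : ∀ n ∈ N, FutureNull n
  parabolic : ∀ n ∈ N, ∃ A ∈ Γ₀, A ≠ 1 ∧ A n = n
  all_cusps : ∀ A ∈ Γ₀, A ≠ 1 → ∀ n, FutureNull n → A n = n → ∃ r : ℝ, 0 < r ∧ r • n ∈ N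
  invariant : ∀ A ∈ Γ₀, ∀ n ∈ N, A n ∈ N
  disjoint : ∀ n ∈ N, ∀ n' ∈ N, n ≠ n' → Disjoint (horodisk n) (horodisk n')

/-- The inverse image in `S₊` of the union of cusp neighbourhoods given by `N`. -/
def horodiskUnion (N : Set R21) : Set Plane := ⋃ n ∈ N, horodisk n

/-- `η` is (the lift to `S₊` of) a smooth 1-form on `S₊/Γ₀` with values in the flat bundle
`(S₊ × ℝ^{2,1})/Γ₀`: an `ℝ^{2,1}`-valued smooth 1-form on `S₊` with `A^*η = η` for `A ∈ Γ₀`,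
where `A^*η = A⁻¹ ∘ η ∘ DA`. Values of `η` outside `S₊` are irrelevant. -/
structure IsBundleForm (Γ₀ : Subgroup (R21 ≃ₗ[ℝ] R21)) (η : Plane → Plane →L[ℝ] R21) :
    Prop where
  smooth : ContDiffOn ℝ ∞ η SPlus
  invariant : ∀ A ∈ Γ₀, ∀ p ∈ SPlus, ∀ u : Plane,
    A.symm (η (act A p) (fderiv ℝ (act A) p u)) = η p u

/-- The form `η` represents, in the de Rham sense, the class of the cocycle `g ↦ b_g` of
translation parts of the elements `g : x ↦ L(g) x + b_g` of `Γ`. Since `S₊` is simply connected,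
this says that `η` has a primitive `s` with `b_g = s(L(g) p) - L(g) s(p)`, i.e. that `η` is the
differential of a section `s` of the flat affine bundle `(S₊ × ℝ^{2,1})/Γ`. -/
def Represents (η : Plane → Plane →L[ℝ] R21) (Γ : Subgroup (R21 ≃ᵃ[ℝ] R21)) : Prop :=
  ∃ s : Plane → R21, (∀ p ∈ SPlus, HasFDerivAt s (η p) p) ∧
    ∀ g ∈ Γ, ∀ p ∈ SPlus, s (act g.linear p) = g (s p)

/-- `η` restricts to a standard cusp 1-form `𝐩 dx`, `𝐩 = k n`, on the horodisk attached to `n`. -/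
def IsStandardCuspFormOn (η : Plane → Plane →L[ℝ] R21) (n : R21) : Prop :=
  ∃ (m : R21) (k : ℝ), B m m = 1 ∧ B m n = 0 ∧
    ∀ p ∈ horodisk n, ∀ u : Plane, η p u = (fderiv ℝ (cuspCoord n m) p u) • (k • n)

/-- The set of hyperbolic elements of `Γ` acting on a geodesic of `S₊` that meets `Khat`. -/
def hyperbolicMeeting (Γ : Subgroup (R21 ≃ᵃ[ℝ] R21)) (Khat : Set Plane) :
    Set (R21 ≃ᵃ[ℝ] R21) :=
  {g | g ∈ Γ ∧ IsHyperbolic g.linear ∧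
    ∃ l : Set Plane, IsGeodesic l ∧ act g.linear '' l = l ∧ (l ∩ Khat).Nonempty}

/-- Space-like geodesics of `ℝ^{2,1}`: affine lines with space-like direction. -/
def IsSpacelikeLine (l : Set R21) : Prop :=
  ∃ q v : R21, 0 < B v v ∧ l = {x | ∃ t : ℝ, x = q + t • v}

end

end Margulis

namespace Margulis

open Filter Topology

/-! Let `s` be the equivariant primitive of the form and let `g` be hyperbolic with axis through `p
∈ Khat`. The point of the hyperboloid over `p` is `α + β` with `α`, `β` null eigenvectors of the
linear part for `r > 1` and `r⁻¹`. The displacement `D = g x₀ - x₀` of `x₀ = s p` is the integral of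
the form over one period of the axis. Adding `c₁ • α + c₂ • β` to `x₀` kills the `α`- and
`β`-components of `D` and gives a point of a `g`-invariant space-like line. Here `c₁ = 2 B β D / (r
- 1)` and `c₂ = -2 B α D / (1 - r⁻¹)`. Suppose the form along every axis, paired with an end point
normalised at the current point, is bounded by `C`. Paired with the fixed vectors `α`, `β` it is
then bounded by `C e^{-t}`, `C e^t`. Integration gives `C (1 - r⁻¹)` and `C (r - 1)`, so both
coefficients are at most `2 C`, whatever the translation length (`AxisPair.exists_spacelike_line`).

The bound `C` is `exists_axis_form_bound`. Outside the horodisks it follows from equivariance and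
compactness, once axis points there are known to lie at bounded distance from the orbit of the base
point. Inside a horodisk the form is `k n dx`; `k` is bounded where the axis leaves the horodisk,
and the decay of `n` against the axis balances the size of `dx`.

The distance bound is geometric finiteness, `exists_thick_axis_bound`. Otherwise points of Dirichlet
domains escape to a null direction `n` that the orbit accumulates while missing a horoball there. A
connected cocompact orbit graph then goes arbitrarily far to one side of `n`. Nearly highest points
of it are brought back to a compact set, the attached horocycle frames subconverge, and planar
separation forces two of them to share their centre, so `n` is a parabolic fixed point. But outside
a horodisk the Dirichlet domain of a parabolic element stays away from its fixed point.

Finally, the form is determined by its restriction to the thick part (`eqOn_of_eqOn_thick`). Two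
admissible primitives thus differ by a translation, which matches up the affine groups and their
invariant lines, so one radius serves all of them. -/

/-! ### Lorentzian linear algebra -/

lemma B_add_left (x y z : R21) : B (x + y) z = B x z + B y z := by simp [B]; ring
lemma B_add_right (x y z : R21) : B x (y + z) = B x y + B x z := by simp [B]; ring
lemma B_sub_left (x y z : R21) : B (x - y) z = B x z - B y z := by simp [B]; ring
lemma B_sub_right (x y z : R21) : B x (y - z) = B x y - B x z := by simp [B]; ring
lemma B_smul_left (c : ℝ) (x y : R21) : B (c • x) y = c * B x y := by simp [B]; ring
lemma B_smul_right (c : ℝ) (x y : R21) : B x (c • y) = c * B x y := by simp [B]; ring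
lemma B_neg_left (x y : R21) : B (-x) y = -B x y := by simp [B]; ring
lemma B_neg_right (x y : R21) : B x (-y) = -B x y := by simp [B]; ring
lemma B_zero_right (y : R21) : B y 0 = 0 := by simp [B]
lemma B_comm (x y : R21) : B x y = B y x := by simp [B]; ring

lemma continuous_B : Continuous fun p : R21 × R21 => B p.1 p.2 := by
  unfold B; fun_prop

lemma _root_.Continuous.lorentz {X : Type*} [TopologicalSpace X] {f g : X → R21}
    (hf : Continuous f) (hg : Continuous g) : Continuous fun x => B (f x) (g x) :=
  continuous_B.comp (hf.prodMk hg)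

lemma _root_.Filter.Tendsto.lorentz {X : Type*} {l : Filter X} {f g : X → R21} {a b : R21}
    (hf : Filter.Tendsto f l (nhds a)) (hg : Filter.Tendsto g l (nhds b)) :
    Filter.Tendsto (fun x => B (f x) (g x)) l (nhds (B a b)) :=
  (continuous_B.tendsto (a, b)).comp (hf.prodMk_nhds hg)

/-- The base point of the hyperboloid. -/
noncomputable def basePt : R21 := !₂[0, 0, 1]

lemma B_basePt (x : R21) : B x basePt = -x 2 := by simp [B, basePt]

lemma futureTimelike_basePt : FutureTimelike basePt := by
  constructor <;> simp [B, basePt]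

lemma ext3 {x y : R21} (h0 : x 0 = y 0) (h1 : x 1 = y 1) (h2 : x 2 = y 2) : x = y := by
  ext i; fin_cases i <;> assumption

/-- The reversed Cauchy-Schwarz inequality on the closed future cone. -/
lemma horizontal_le {u x : R21} (hu : B u u ≤ 0) (hx : B x x ≤ 0) (hu2 : 0 ≤ u 2)
    (hx2 : 0 ≤ x 2) : |u 0 * x 0 + u 1 * x 1| ≤ u 2 * x 2 := by
  apply abs_le_of_sq_le_sq _ (by positivity)
  simp only [B] at hu hx
  have h1 : u 0 * u 0 + u 1 * u 1 ≤ u 2 * u 2 := by linarith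
  have h2 : x 0 * x 0 + x 1 * x 1 ≤ x 2 * x 2 := by linarith
  have h3 := mul_le_mul h1 h2 (by nlinarith [sq_nonneg (x 0), sq_nonneg (x 1)])
    (by nlinarith [sq_nonneg (u 2)])
  nlinarith [sq_nonneg (u 0 * x 1 - u 1 * x 0)]

lemma B_nonpos {u x : R21} (hu : B u u ≤ 0) (hx : B x x ≤ 0) (hu2 : 0 ≤ u 2)
    (hx2 : 0 ≤ x 2) : B u x ≤ 0 := by
  have := (abs_le.1 (horizontal_le hu hx hu2 hx2)).2
  simp only [B]; linarith

lemma horizontal_lt {u x : R21} (hu : B u u < 0) (hx : B x x ≤ 0) (hu2 : 0 < u 2)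
    (hx2 : 0 < x 2) : |u 0 * x 0 + u 1 * x 1| < u 2 * x 2 := by
  apply abs_lt_of_sq_lt_sq _ (by positivity)
  simp only [B] at hu hx
  have h1 : u 0 * u 0 + u 1 * u 1 < u 2 * u 2 := by linarith
  have h2 : x 0 * x 0 + x 1 * x 1 ≤ x 2 * x 2 := by linarith
  have h3 : (u 0 * u 0 + u 1 * u 1) * (x 0 * x 0 + x 1 * x 1) < (u 2 * u 2) * (x 2 * x 2) :=
    calc _ ≤ (u 0 * u 0 + u 1 * u 1) * (x 2 * x 2) :=
          mul_le_mul_of_nonneg_left h2 (by nlinarith [sq_nonneg (u 0), sq_nonneg (u 1)])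
      _ < _ := mul_lt_mul_of_pos_right h1 (by positivity)
  nlinarith [sq_nonneg (u 0 * x 1 - u 1 * x 0)]

lemma B_neg_of_timelike {u x : R21} (hu : FutureTimelike u) (hx : B x x ≤ 0) (hx2 : 0 < x 2) :
    B u x < 0 := by
  have := (abs_lt.1 (horizontal_lt hu.1 hx hu.2 hx2)).2
  simp only [B]; linarith

lemma FutureTimelike.B_neg {u x : R21} (hu : FutureTimelike u) (hx : FutureTimelike x) :
    B u x < 0 := B_neg_of_timelike hu hx.1.le hx.2

lemma FutureNull.B_neg {u x : R21} (hu : FutureNull u) (hx : FutureTimelike x) :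
    B u x < 0 := by rw [B_comm]; exact B_neg_of_timelike hx hu.1.le hu.2

lemma time_pos_of_B_neg {u x : R21} (hu : FutureTimelike u) (hx : B x x ≤ 0) (h : B u x < 0) :
    0 < x 2 := by
  by_contra! hc
  have h2 : B (-x) (-x) ≤ 0 := by rw [B_neg_left, B_neg_right, neg_neg]; exact hx
  have := B_nonpos hu.1.le h2 hu.2.le (by simpa using hc)
  rw [B_neg_right] at this
  linarith

lemma FutureTimelike.add {u x : R21} (hu : FutureTimelike u) (hx : B x x ≤ 0) (hx2 : 0 ≤ x 2) :
    FutureTimelike (u + x) := by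
  have h1 := hu.1
  have h2 := B_nonpos hu.1.le hx hu.2.le hx2
  refine ⟨?_, ?_⟩
  · rw [B_add_left, B_add_right, B_add_right, B_comm x u]; linarith
  · have := hu.2; simp only [PiLp.add_apply]; linarith

lemma FutureTimelike.smul {u : R21} (hu : FutureTimelike u) {c : ℝ} (hc : 0 < c) :
    FutureTimelike (c • u) := by
  have h1 := hu.1
  have h2 := hu.2
  refine ⟨?_, by simp only [PiLp.smul_apply, smul_eq_mul]; positivity⟩
  rw [B_smul_left, B_smul_right]
  have := mul_pos hc hc
  nlinarith

lemma isOpen_futureTimelike : IsOpen {V : R21 | FutureTimelike V} := by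
  refine IsOpen.inter (isOpen_lt (continuous_id.lorentz continuous_id) continuous_const)
    (isOpen_lt continuous_const (f := fun _ => (0 : ℝ)) (g := fun V : R21 => V 2) (by fun_prop))

/-- Vectors orthogonal to a timelike vector are space-like. -/
lemma B_self_nonneg_of_orthogonal {u x : R21} (hu : FutureTimelike u) (h : B u x = 0) :
    0 ≤ B x x := by
  by_contra! hc
  have hx2 : x 2 ≠ 0 := by
    intro h0
    simp only [B, h0] at hc
    nlinarith [sq_nonneg (x 0), sq_nonneg (x 1)]
  rcases lt_or_gt_of_ne hx2 with h2 | h2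
  · have := hu.B_neg (x := -x) ⟨by rw [B_neg_left, B_neg_right, neg_neg]; exact hc, by simpa using h2⟩
    rw [B_neg_right] at this
    linarith
  · have := hu.B_neg ⟨hc, h2⟩
    linarith

/-- The Cauchy-Schwarz inequality on the orthogonal complement of a timelike vector. -/
lemma sq_B_le {u x y : R21} (hu : FutureTimelike u) (hx : B u x = 0) (hy : B u y = 0) :
    B x y ^ 2 ≤ B x x * B y y := by
  have h : ∀ t : ℝ, 0 ≤ B x x * (t * t) + (2 * B x y) * t + B y y := by
    intro t
    have := B_self_nonneg_of_orthogonal (u := u) (x := t • x + y) hu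
      (by rw [B_add_right, B_smul_right, hx, hy]; ring)
    simp only [B_add_left, B_add_right, B_smul_left, B_smul_right, B_comm y x] at this
    linarith
  have := discrim_le_zero h
  simp only [discrim] at this
  linarith

/-! ### Null frames -/

/-- `n`, `n'` is a hyperbolic pair of null vectors and `m` is a unit vector orthogonal to it. -/
structure NullFrame (n m n' : R21) : Prop where
  nn : B n n = 0
  mm : B m m = 1
  nn' : B n' n' = 0
  nm : B n m = 0
  pair : B n n' = -1
  mn' : B m n' = 0

lemma NullFrame.expand {n m n' : R21} (h : NullFrame n m n') (x : R21) :
    x = (-B n' x) • n + B m x • m + (-B n x) • n' := by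
  have h' : ∀ a b c : ℝ, B n (a • n + b • m + c • n') = -c ∧
      B m (a • n + b • m + c • n') = b ∧ B n' (a • n + b • m + c • n') = -a := by
    intro a b c
    simp only [B_add_right, B_smul_right, h.nn, h.nm, h.pair, h.mm, h.mn', h.nn',
      B_comm m n, B_comm n' n, B_comm n' m]
    refine ⟨by ring, by ring, by ring⟩
  have hli : LinearIndependent ℝ ![n, m, n'] := by
    rw [Fintype.linearIndependent_iff]
    intro g hg
    simp only [Fin.sum_univ_three, Matrix.cons_val] at hg
    obtain ⟨h1, h2, h3⟩ := h' (g 0) (g 1) (g 2)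
    rw [hg, B_zero_right] at h1 h2 h3
    intro i
    fin_cases i
    · simp; linarith
    · simp; linarith
    · simp; linarith
  have hsp := hli.span_eq_top_of_card_eq_finrank' (by simp)
  have hx : x ∈ Submodule.span ℝ (Set.range ![n, m, n']) := by rw [hsp]; trivial
  rw [Submodule.mem_span_range_iff_exists_fun] at hx
  obtain ⟨g, hg⟩ := hx
  simp only [Fin.sum_univ_three, Matrix.cons_val] at hg
  obtain ⟨h1, h2, h3⟩ := h' (g 0) (g 1) (g 2)
  rw [hg] at h1 h2 h3
  rw [h1, h2, h3, neg_neg, neg_neg, hg]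

lemma NullFrame.B_self {n m n' : R21} (h : NullFrame n m n') (x : R21) :
    B x x = B m x ^ 2 - 2 * B n x * B n' x := by
  conv_lhs => rw [h.expand x]
  simp only [B_add_right, B_smul_right, B_add_left, B_smul_left, h.nn, h.nm, h.pair, h.mm, h.mn',
    h.nn', B_comm m n, B_comm n' n, B_comm n' m]
  ring

/-- The Lorentzian cross product of `n` and `n'` is orthogonal to both; its square is `(B n n') ^ 2`
because both are null. -/
lemma exists_nullFrame_of_pair {n n' : R21} (hn : B n n = 0) (hn' : B n' n' = 0)
    (h : B n n' = -1) : ∃ m, NullFrame n m n' := by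
  refine ⟨!₂[n 1 * n' 2 - n 2 * n' 1, n 2 * n' 0 - n 0 * n' 2, n 1 * n' 0 - n 0 * n' 1],
    hn, ?_, hn', ?_, h, ?_⟩
  · simp only [B] at *
    simp
    linear_combination (n 0 * n' 0 + n 1 * n' 1 - n 2 * n' 2 - 1) * h -
      (n' 0 * n' 0 + n' 1 * n' 1 - n' 2 * n' 2) * hn
  · simp [B]; ring
  · simp [B]; ring

lemma FutureNull.exists_nullFrame {n : R21} (hn : FutureNull n) :
    ∃ m n', NullFrame n m n' ∧ FutureNull n' := by
  obtain ⟨h1, h2⟩ := hn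
  have h1' := h1
  simp only [B] at h1'
  have hn'0 : FutureNull (!₂[-n 0 / (2 * n 2 ^ 2), -n 1 / (2 * n 2 ^ 2), n 2 / (2 * n 2 ^ 2)]) := by
    refine ⟨?_, by simp; positivity⟩
    simp only [B]
    simp
    field_simp
    linarith
  obtain ⟨m, hm⟩ := exists_nullFrame_of_pair (n := n) h1 hn'0.1 (by
    simp only [B]
    simp
    field_simp
    linarith)
  exact ⟨m, _, hm, hn'0⟩

/-! ### Planar separation in the hyperbolic plane -/

/-- In the upper half-plane model attached to the null vector `n` and the unit vector `m`, the
region `{|x| ≤ 1, y > 2}`, as a cone. -/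
def cuspBox (n m : R21) : Set R21 :=
  {x | |B m x| ≤ -B n x ∧ 4 * B n x ^ 2 < -B x x}

set_option maxHeartbeats 800000 in
/-- A connected set of time-like vectors cannot avoid both the part of the vertical geodesic at `n`
above some point and a path from that point to an ideal point `ν` to the right of the geodesic,
if it has points on the vertical geodesic and points arbitrarily far to the right. -/
lemma false_of_preconnected_of_avoids {X : Set R21} (hX : IsPreconnected X)
    (hXt : ∀ x ∈ X, FutureTimelike x) {V n m ν μ : R21}
    (hV : B V V = -1) (hn : B n n = 0) (hVn : B V n = -1) (hm : B m m = 1) (hmn : B m n = 0)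
    (hmV : B m V = 0) (hν : B ν ν = 0) (hμν : B μ ν = 0)
    (hXn : ∀ x ∈ X, B n x < 0) (hXν : ∀ x ∈ X, B ν x < 0)
    (h1 : Disjoint X (cuspBox n m)) (h2 : Disjoint X (cuspBox ν μ))
    (hclose : |B μ (V + (4 : ℝ) • n)| ≤ -B ν (V + (4 : ℝ) • n))
    (hclose' : 4 * B ν (V + (4 : ℝ) • n) ^ 2 < 9) (hPν : B ν (V + (4 : ℝ) • n) < 0)
    (hb : 0 < B m ν) (hx₀ : ∃ x ∈ X, B m x = 0)
    (hunb : ∀ T : ℝ, ∃ x ∈ X, T * (-B n x) ≤ B m x) : False := by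
  -- In the half-plane coordinates of `n`, `m`, the point `V` is `(0, 1)` and `P` is `(0, 3)`, so
  -- the vertical ray above `P` lies in `cuspBox n m`.
  set P := V + (4 : ℝ) • n with hP
  set n' := V - (1 / 2 : ℝ) • n with hn'
  have F : NullFrame n m n' := by
    refine ⟨hn, hm, ?_, by rw [B_comm]; exact hmn, ?_, ?_⟩
    · rw [hn']; simp only [B_sub_left, B_sub_right, B_smul_left, B_smul_right, B_comm n V, hV, hVn,
        hn]; norm_num
    · rw [hn']; simp only [B_sub_right, B_smul_right, B_comm n V, hVn, hn]; norm_num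
    · rw [hn']; simp only [B_sub_right, B_smul_right, hmV, hmn]; norm_num
  have hPn' : P = n' + (9 / 2 : ℝ) • n := by
    rw [hP, hn']; module
  have hPP : B P P = -9 := by
    rw [hPn']; simp only [B_add_left, B_add_right, B_smul_left, B_smul_right, F.nn', F.nn, F.pair,
      B_comm n' n]; norm_num
  have hPn : B P n = -1 := by
    rw [hPn']; simp only [B_add_left, B_smul_left, F.nn, F.pair, B_comm n' n]; norm_num
  have hPm : B m P = 0 := by
    rw [hPn']; simp only [B_add_right, B_smul_right, F.mn', hmn]; norm_num
  obtain ⟨a, ha⟩ : ∃ a, a = -B n' ν := ⟨_, rfl⟩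
  obtain ⟨b, hbdef⟩ : ∃ b, b = B m ν := ⟨_, rfl⟩
  obtain ⟨c, hc⟩ : ∃ c, c = -B n ν := ⟨_, rfl⟩
  have hb0 : 0 < b := hbdef ▸ hb
  -- `M` is normal to the plane through `P` and `ν`, that is, to the geodesic from `P` to the ideal
  -- point `ν`; `z` is what orthogonality to `ν` requires.
  set z := (9 / 2 * c - a) / b with hz
  set M := (9 / 2 : ℝ) • n + z • m - n' with hM
  have hMx : ∀ x, B M x = 9 / 2 * B n x + z * B m x - B n' x := by
    intro x; rw [hM]; simp only [B_sub_left, B_add_left, B_smul_left]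
  have hMn : B M n = 1 := by rw [hMx, hn, hmn, B_comm n' n, F.pair]; norm_num
  have hMP : B M P = 0 := by
    rw [hMx, hPm, B_comm n P, hPn, hPn']
    simp only [B_add_right, B_smul_right, F.nn', B_comm n' n, F.pair]; norm_num
  have hMν : B M ν = 0 := by
    rw [hMx, ← hbdef, show B n ν = -c by rw [hc]; ring, show B n' ν = -a by rw [ha]; ring, hz]
    field_simp; ring
  -- the vertical ray
  have hvert : ∀ x ∈ X, B m x = 0 → 0 ≤ B M x → False := by
    intro x hx hmx hMx0
    have hxe : x = (-B n x) • P + (B M x) • n := by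
      conv_lhs => rw [F.expand x]
      rw [hmx, hPn', hMx, hmx]; module
    have hpos := hXn x hx
    refine Set.disjoint_left.1 h1 hx ⟨by rw [hmx]; simp; exact hpos.le, ?_⟩
    have : B x x = B n x ^ 2 * (-9) - 2 * (-B n x) * B M x := by
      conv_lhs => rw [hxe]
      simp only [B_add_left, B_add_right, B_smul_left, B_smul_right, hPP, B_comm n P, hPn, hn]; ring
    rw [this]
    have h3 := mul_nonneg (neg_nonneg.2 hpos.le) hMx0
    have h4 := sq_pos_of_neg hpos
    linarith
  -- the plane spanned by `P` and `ν`
  have hspan : ∀ x, B M x = 0 → ∃ p q : ℝ, x = p • P + q • ν := by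
    intro x hx
    have e1 := F.expand x
    have e2 := F.expand ν
    rw [← ha, ← hbdef, ← hc] at e2
    have h3 : B n' x = 9 / 2 * B n x + z * B m x := by have := hMx x; linarith
    refine ⟨-B n x - B m x / b * c, B m x / b, ?_⟩
    conv_lhs => rw [e1, h3]
    conv_rhs => rw [e2, hPn']
    have : z * b = 9 / 2 * c - a := by rw [hz]; field_simp
    have h4 : z * B m x = B m x / b * (9 / 2 * c - a) := by rw [← this]; field_simp
    rw [h4]
    have h5 : B m x / b * b = B m x := by field_simp
    match_scalars
    · ring
    · linarith
    · ring
  have hcirc : ∀ x ∈ X, B M x = 0 → 0 ≤ B m x → False := by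
    intro x hx hMx0 hmx
    obtain ⟨p, q, rfl⟩ := hspan x hMx0
    have hq : 0 ≤ q := by
      simp only [B_add_right, B_smul_right, hPm, ← hbdef] at hmx
      exact nonneg_of_mul_nonneg_left (by linarith) hb0
    have hνx := hXν _ hx
    have e1 : B ν (p • P + q • ν) = p * B ν P := by
      simp only [B_add_right, B_smul_right, hν]; ring
    have hp : 0 < p := by
      rw [e1] at hνx
      exact pos_of_mul_neg_left hνx hPν.le
    have e2 : B μ (p • P + q • ν) = p * B μ P := by
      simp only [B_add_right, B_smul_right, hμν]; ring
    refine Set.disjoint_left.1 h2 hx ⟨?_, ?_⟩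
    · rw [e1, e2, abs_mul, abs_of_pos hp]
      have := mul_le_mul_of_nonneg_left hclose hp.le
      linarith
    · rw [e1]
      simp only [B_add_left, B_add_right, B_smul_left, B_smul_right, hPP, B_comm P ν, hν]
      have h6 : p * (q * B ν P) ≤ 0 := by
        rw [← mul_assoc]
        exact mul_nonpos_of_nonneg_of_nonpos (mul_nonneg hp.le hq) hPν.le
      have h7 : p ^ 2 * (4 * B ν P ^ 2) < p ^ 2 * 9 :=
        mul_lt_mul_of_pos_left hclose' (by positivity)
      linarith
  -- The region to the right of the vertical ray and above the ray from `P` to `ν`. Its boundary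
  -- consists of these two rays, both missed by `X`.
  set U : Set R21 := {x | 0 < B m x} ∩ {x | 0 < B M x} with hU
  have hUo : IsOpen U := (isOpen_lt continuous_const (continuous_const.lorentz continuous_id)).inter
    (isOpen_lt continuous_const (continuous_const.lorentz continuous_id))
  set W : Set R21 := {x | B m x < 0} ∪ {x | B M x < 0} with hW
  have hWo : IsOpen W := (isOpen_lt (continuous_const.lorentz continuous_id) continuous_const).union
    (isOpen_lt (continuous_const.lorentz continuous_id) continuous_const)
  have hcov : X ⊆ U ∪ W := by
    intro x hx
    by_contra hcon
    rw [Set.mem_union, not_or] at hcon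
    obtain ⟨hu, hw⟩ := hcon
    simp only [hW, Set.mem_union, Set.mem_ofPred_eq, not_or, not_lt] at hw
    simp only [hU, Set.mem_inter_iff, Set.mem_ofPred_eq, not_and, not_lt] at hu
    rcases hw.1.eq_or_lt with h | h
    · exact hvert x hx h.symm hw.2
    · exact hcirc x hx (le_antisymm (hu h) hw.2) hw.1
  obtain ⟨x₀, hx₀X, hx₀m⟩ := hx₀
  have hx₀W : x₀ ∈ W := by
    rcases hcov hx₀X with h | h
    · exact absurd hx₀m (ne_of_gt h.1)
    · exact h
  -- In half-plane coordinates `B M` has the sign of `x² + y² + 2zx - 9`, which is positive once `x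
  -- ≥ 2|z| + 4`.
  obtain ⟨x₁, hx₁X, hx₁⟩ := hunb (2 * |z| + 4)
  have hx₁U : x₁ ∈ U := by
    have hn1 := hXn x₁ hx₁X
    have hbx : 0 < B m x₁ := by
      refine lt_of_lt_of_le ?_ hx₁
      have : 0 ≤ |z| := abs_nonneg z
      exact mul_pos (by linarith) (by linarith)
    refine ⟨hbx, ?_⟩
    have h3 := F.B_self x₁
    have h4 := (hXt x₁ hx₁X).1
    show 0 < B M x₁
    rw [hMx]
    by_contra! hneg
    have h5 : (-B n x₁) * (9 / 2 * B n x₁ + z * B m x₁ - B n' x₁) ≤ 0 :=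
      mul_nonpos_of_nonneg_of_nonpos (by linarith) hneg
    have h6 : -|z| * B m x₁ ≤ z * B m x₁ := mul_le_mul_of_nonneg_right (neg_abs_le z) hbx.le
    have h7 := abs_nonneg z
    generalize B m x₁ = β at *
    generalize B n x₁ = γ at *
    generalize B n' x₁ = δ at *
    have h8 : β ^ 2 < 2 * γ * δ := by linarith
    have h9 : γ * δ ≤ 9 / 2 * γ ^ 2 + |z| * β * (-γ) := by
      have := mul_le_mul_of_nonneg_right h6 (neg_nonneg.2 hn1.le)
      linarith
    have h10 : 4 * (-γ) ≤ β := by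
      have := mul_nonneg h7 (neg_nonneg.2 hn1.le)
      linarith
    have h11 : |z| * (-γ) ≤ β / 2 - 2 * (-γ) := by linarith
    have h12 : |z| * (-γ) * β ≤ (β / 2 - 2 * (-γ)) * β := mul_le_mul_of_nonneg_right h11 hbx.le
    have h13 : (-γ) * (4 * (-γ)) ≤ (-γ) * β := mul_le_mul_of_nonneg_left h10 (by linarith)
    have h14 : 0 < γ ^ 2 := sq_pos_of_neg hn1
    linarith
  obtain ⟨x, hxX, hxU, hxW⟩ := hX U W hUo hWo hcov ⟨x₁, hx₁X, hx₁U⟩ ⟨x₀, hx₀X, hx₀W⟩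
  rcases hxW with h | h
  · exact lt_asymm (show B m x < 0 from h) hxU.1
  · exact lt_asymm (show B M x < 0 from h) hxU.2

/-! ### Renormalised horocycle frames and parabolic fixed points -/

lemma time_sq_le {V W : R21} (hV : B V V = -1) (hVW : B V W = 0) :
    W 2 ^ 2 ≤ B W W * (V 2 ^ 2 - 1) := by
  simp only [B] at *
  have h1 : W 2 * V 2 = W 0 * V 0 + W 1 * V 1 := by linarith
  have h2 : V 0 ^ 2 + V 1 ^ 2 = V 2 ^ 2 - 1 := by linarith
  have h3 : (W 2 * V 2) ^ 2 ≤ (W 0 ^ 2 + W 1 ^ 2) * (V 0 ^ 2 + V 1 ^ 2) := by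
    rw [h1]; nlinarith [sq_nonneg (W 0 * V 1 - W 1 * V 0)]
  rw [h2] at h3
  nlinarith

lemma norm_sq_eq_B (x : R21) : ‖x‖ ^ 2 = B x x + 2 * x 2 ^ 2 := by
  rw [EuclideanSpace.real_norm_sq_eq, Fin.sum_univ_three]
  simp only [B]; ring

/-- Split `x` into a multiple of `V` and a part orthogonal to `V`; on the latter the form is
nonnegative and, for `V` of bounded height, controls the time coordinate. -/
lemma exists_norm_bound (a b R : ℝ) : ∃ C : ℝ, ∀ V x : R21, B V V = -1 → 0 < V 2 → V 2 ≤ R →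
    |B V x| ≤ a → B x x ≤ b → ‖x‖ ≤ C := by
  refine ⟨√(b + 2 * (2 * ((b + a ^ 2) * R ^ 2) + 2 * (a ^ 2 * R ^ 2))), fun V x hV h0 hR ha hb => ?_⟩
  apply Real.le_sqrt_of_sq_le
  rw [norm_sq_eq_B]
  set W := x + (B V x) • V with hW
  have hVW : B V W = 0 := by rw [hW, B_add_right, B_smul_right, hV]; ring
  have hWW : B W W = B x x + B V x ^ 2 := by
    rw [hW]; simp only [B_add_left, B_add_right, B_smul_left, B_smul_right, hV, B_comm x V]; ring
  have h1 := time_sq_le hV hVW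
  have hW0 : 0 ≤ B W W := B_self_nonneg_of_orthogonal ⟨by rw [hV]; norm_num, h0⟩ hVW
  have ha2 : B V x ^ 2 ≤ a ^ 2 := sq_le_sq' (abs_le.1 ha).1 (abs_le.1 ha).2
  have hR2 : V 2 ^ 2 ≤ R ^ 2 := pow_le_pow_left₀ h0.le hR 2
  have h2 : W 2 ^ 2 ≤ (b + a ^ 2) * R ^ 2 :=
    h1.trans (mul_le_mul (by linarith) (by linarith) (by
      have hp : 1 ≤ V 2 ^ 2 := by simp only [B] at hV; nlinarith [sq_nonneg (V 0), sq_nonneg (V 1)]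
      linarith) (by linarith))
  have h3 : x 2 = W 2 - B V x * V 2 := by simp [hW]
  have h4 : (B V x * V 2) ^ 2 ≤ a ^ 2 * R ^ 2 := by
    rw [mul_pow]; exact mul_le_mul ha2 hR2 (sq_nonneg _) (sq_nonneg _)
  rw [h3]
  nlinarith [sq_nonneg (W 2 + B V x * V 2)]

/-- Among the points of a set of bounded height far to the right there is one that is, up to a
factor two, highest in a window of hyperbolically bounded size around it. -/
lemma exists_nearly_highest {X : Set R21} {n m : R21} {M : ℝ} (hM : 0 < M)
    (hXt : ∀ x ∈ X, FutureTimelike x) (hXn : ∀ x ∈ X, B n x < 0)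
    (hy : ∀ x ∈ X, -B x x ≤ M ^ 2 * B n x ^ 2)
    (hunb : ∀ T : ℝ, ∃ x ∈ X, T * (-B n x) ≤ B m x) (T : ℝ) :
    ∃ t y : ℝ, ∃ x ∈ X, 0 < y ∧ y ≤ M ∧ T ≤ t ∧ B m x = t * (-B n x) ∧
      -B x x = y ^ 2 * B n x ^ 2 ∧ Disjoint X (cuspBox (y • n) (m + t • n)) := by
  set Y : R21 → ℝ := fun x => √(-B x x) / (-B n x) with hY
  set t : R21 → ℝ := fun x => B m x / (-B n x) with ht
  have hYpos : ∀ x ∈ X, 0 < Y x := fun x hx =>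
    div_pos (Real.sqrt_pos.2 (by have := (hXt x hx).1; linarith)) (by have := hXn x hx; linarith)
  have hYsq : ∀ x ∈ X, -B x x = Y x ^ 2 * B n x ^ 2 := by
    intro x hx
    have h1 := (hXn x hx).ne
    simp only [hY]
    rw [div_pow, Real.sq_sqrt (by have := (hXt x hx).1; linarith)]
    field_simp
  have hYM : ∀ x ∈ X, Y x ≤ M := by
    intro x hx
    have h1 := hy x hx
    rw [hYsq x hx] at h1
    have h2 := le_of_mul_le_mul_right h1 (sq_pos_of_neg (hXn x hx))
    exact le_of_sq_le_sq h2 hM.le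
  have htm : ∀ x ∈ X, B m x = t x * (-B n x) := by
    intro x hx
    have h1 := (hXn x hx).ne
    simp only [ht]
    field_simp
  -- The constraint is on `t + Y`, not on `t` alone: a point within horizontal distance `Y x` of `x`
  -- and more than twice as high still satisfies it, which contradicts the choice of `x` above half
  -- the supremum.
  set S : Set ℝ := {r | ∃ x ∈ X, r = Y x ∧ T + M ≤ t x + Y x} with hS
  have hSb : BddAbove S := ⟨M, by rintro _ ⟨x, hx, rfl, -⟩; exact hYM x hx⟩
  obtain ⟨x₀, hx₀, hTx₀⟩ := hunb (T + M)
  have hx₀S : Y x₀ ∈ S := by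
    refine ⟨x₀, hx₀, rfl, ?_⟩
    have h1 : T + M ≤ t x₀ := by
      rw [htm x₀ hx₀] at hTx₀
      exact le_of_mul_le_mul_right hTx₀ (by have := hXn x₀ hx₀; linarith)
    have := hYpos x₀ hx₀
    linarith
  have hsup : 0 < sSup S := (hYpos x₀ hx₀).trans_le (le_csSup hSb hx₀S)
  obtain ⟨_, ⟨x, hx, rfl, hxT⟩, hlt⟩ := exists_lt_of_lt_csSup ⟨_, hx₀S⟩ (half_lt_self hsup)
  refine ⟨t x, Y x, x, hx, hYpos x hx, hYM x hx, by have := hYM x hx; linarith, htm x hx,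
    hYsq x hx, ?_⟩
  rw [Set.disjoint_left]
  rintro x' hx' ⟨h1, h2⟩
  have hn' := hXn x' hx'
  rw [B_add_left, B_smul_left, B_smul_left, htm x' hx'] at h1
  rw [B_smul_left, hYsq x' hx'] at h2
  have h3 : |t x' - t x| ≤ Y x := by
    have : t x' * (-B n x') + t x * B n x' = (t x' - t x) * (-B n x') := by ring
    rw [this, abs_mul, abs_of_pos (neg_pos.2 hn')] at h1
    have h5 : |t x' - t x| * (-B n x') ≤ Y x * (-B n x') := by linarith
    exact le_of_mul_le_mul_right h5 (neg_pos.2 hn')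
  have h4 : 2 * Y x < Y x' := by
    have h5 : (2 * Y x) ^ 2 * B n x' ^ 2 < Y x' ^ 2 * B n x' ^ 2 := by
      rw [mul_pow] at h2; linarith
    have h6 := lt_of_mul_lt_mul_right h5 (sq_nonneg _)
    exact lt_of_pow_lt_pow_left₀ 2 (hYpos x' hx').le h6
  have h7 : Y x' ∈ S := ⟨x', hx', rfl, by have := (abs_le.1 h3).1; linarith⟩
  have := le_csSup hSb h7
  linarith

/-- `V` is a point of the hyperboloid, `n` the null vector of a horodisk with `V` on its
boundary, and `m` the unit tangent vector at `V` of that horocycle. -/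
structure HoroFrame (V n m : R21) : Prop where
  VV : B V V = -1
  nn : B n n = 0
  Vn : B V n = -1
  mm : B m m = 1
  mn : B m n = 0
  mV : B m V = 0

lemma HoroFrame.nullFrame {V n m : R21} (h : HoroFrame V n m) :
    NullFrame n m (V - (1 / 2 : ℝ) • n) := by
  refine ⟨h.nn, h.mm, ?_, by rw [B_comm]; exact h.mn, ?_, ?_⟩
  · simp only [B_sub_left, B_sub_right, B_smul_left, B_smul_right, B_comm n V, h.VV, h.Vn,
      h.nn]; norm_num
  · simp only [B_sub_right, B_smul_right, B_comm n V, h.Vn, h.nn]; norm_num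
  · simp only [B_sub_right, B_smul_right, h.mV, h.mn]; norm_num

/-- If a second frame is close to the first one, the null vectors of the two frames either
are parallel or lie to opposite sides of each other. -/
lemma HoroFrame.sign_change {V n m ν μ : R21} (h : HoroFrame V n m) (hν : B ν ν = 0)
    (hμν : B μ ν = 0) (ha : 0 < -B (V - (1 / 2 : ℝ) • n) ν)
    (hG : 0 < B m μ + B (V - (1 / 2 : ℝ) • n) μ * B m ν / (2 * -B (V - (1 / 2 : ℝ) • n) ν))
    (h1 : B m ν ≤ 0) (h2 : B μ n ≤ 0) : ν = (-B (V - (1 / 2 : ℝ) • n) ν) • n := by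
  have F := h.nullFrame
  set n' := V - (1 / 2 : ℝ) • n with hn'
  have e1 := F.B_self ν
  have e2 : B μ ν = B m μ * B m ν - B n μ * B n' ν - B n' μ * B n ν := by
    conv_lhs => rw [F.expand μ]
    simp only [B_add_left, B_smul_left]; ring
  have e3 := F.expand ν
  have hb : B m ν = 0 := by
    by_contra hne
    have hneg : B m ν < 0 := lt_of_le_of_ne h1 hne
    rw [hν] at e1
    rw [hμν] at e2
    rw [B_comm μ n] at h2
    -- As `ν` is null, its `n'`-coordinate is quadratic in `B m ν`. Orthogonality of `μ` and `ν`
    -- then equates `B m ν`, times the positive quantity of `hG`, with a nonnegative number.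
    have e4 : B n ν = -(B m ν ^ 2) / (2 * -B n' ν) := by
      rw [eq_div_iff (mul_pos two_pos ha).ne']; linarith
    rw [e4] at e2
    have e5 : B m ν * (B m μ + B n' μ * B m ν / (2 * -B n' ν)) = -B n μ * -B n' ν := by
      have : B m ν * (B m μ + B n' μ * B m ν / (2 * -B n' ν)) =
        B m μ * B m ν - B n' μ * (-(B m ν ^ 2) / (2 * -B n' ν)) := by ring
      rw [this]; linarith
    have e6 := mul_neg_of_neg_of_pos hneg hG
    have e7 := mul_nonneg (neg_nonneg.2 h2) ha.le
    linarith
  have hc : B n ν = 0 := by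
    rw [hν, hb] at e1
    have : B n ν * -B n' ν = 0 := by linarith
    rcases mul_eq_zero.1 this with h | h
    · exact h
    · exact absurd h ha.ne'
  rw [hb, hc] at e3
  simpa using e3

/-- A horodisk based at a frame, seen from a connected set `X`: the box above the base point is
avoided, the base point is aligned with a point of `X`, and `X` is unbounded to the right. -/
structure SeesFromRight (X : Set R21) (V n m : R21) : Prop where
  frame : HoroFrame V n m
  neg : ∀ x ∈ X, B n x < 0
  disj : Disjoint X (cuspBox n m)
  aligned : ∃ x ∈ X, B m x = 0
  unbounded : ∀ T : ℝ, ∃ x ∈ X, T * (-B n x) ≤ B m x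

lemma SeesFromRight.map {X : Set R21} {V n m : R21} (h : SeesFromRight X V n m)
    {A : R21 ≃ₗ[ℝ] R21} (hA : ∀ x y, B (A x) (A y) = B x y) (hX : ∀ x ∈ X, A x ∈ X)
    (hX' : ∀ x ∈ X, A.symm x ∈ X) : SeesFromRight X (A V) (A n) (A m) := by
  have hs : ∀ x y, B (A x) y = B x (A.symm y) := fun x y => by
    rw [← hA x (A.symm y), A.apply_symm_apply]
  refine ⟨⟨?_, ?_, ?_, ?_, ?_, ?_⟩, ?_, ?_, ?_, ?_⟩
  · rw [hA, h.frame.VV]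
  · rw [hA, h.frame.nn]
  · rw [hA, h.frame.Vn]
  · rw [hA, h.frame.mm]
  · rw [hA, h.frame.mn]
  · rw [hA, h.frame.mV]
  · intro x hx; rw [hs]; exact h.neg _ (hX' x hx)
  · rw [Set.disjoint_left]
    rintro x hx ⟨h1, h2⟩
    refine Set.disjoint_left.1 h.disj (hX' x hx) ⟨by rw [← hs, ← hs]; exact h1, ?_⟩
    rw [← hs, ← hA (A.symm x), A.apply_symm_apply]; exact h2
  · obtain ⟨x, hx, hx0⟩ := h.aligned
    exact ⟨A x, hX x hx, by rw [hA, hx0]⟩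
  · intro T
    obtain ⟨x, hx, hxT⟩ := h.unbounded T
    exact ⟨A x, hX x hx, by rw [hA, hA]; exact hxT⟩

/-- Were `ν` to the right of `n`, the ray from `V + 4n` to `ν` would lie in the box of the second
frame and cut `X` in two. The tolerance `1 / 4` gives the width and height conditions of that box at
`V + 4n`. -/
lemma SeesFromRight.not_right {X : Set R21} (hX : IsPreconnected X)
    (hXt : ∀ x ∈ X, FutureTimelike x) {V n m V' ν μ : R21}
    (h : SeesFromRight X V n m) (h' : SeesFromRight X V' ν μ)
    (hclose : |B μ (V + (4 : ℝ) • n)| < 1 / 4)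
    (hclose' : |B ν (V + (4 : ℝ) • n) + 1| < 1 / 4) : B m ν ≤ 0 := by
  by_contra! hb
  rw [abs_lt] at hclose'
  refine false_of_preconnected_of_avoids hX hXt h.frame.VV h.frame.nn h.frame.Vn h.frame.mm
    h.frame.mn h.frame.mV h'.frame.nn h'.frame.mn h.neg h'.neg h.disj h'.disj ?_ ?_ ?_ hb
    h.aligned h.unbounded
  · linarith
  · nlinarith
  · linarith

/-- A null direction `n` which is accumulated from the right by a connected cocompact invariant set
`X` of a group of isometries, and such that `X` does not enter some horoball at `n`, is fixed
by a nontrivial element of the group. -/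
lemma exists_fixing_of_unbounded {Γ₀ : Subgroup (R21 ≃ₗ[ℝ] R21)}
    (hB : ∀ A ∈ Γ₀, ∀ x y, B (A x) (A y) = B x y)
    {X Q : Set R21} (hX : IsPreconnected X) (hXt : ∀ x ∈ X, FutureTimelike x)
    (hXinv : ∀ A ∈ Γ₀, ∀ x ∈ X, A x ∈ X) (hQ : IsCompact Q) (hQX : Q ⊆ X)
    (hcob : ∀ x ∈ X, ∃ A ∈ Γ₀, A x ∈ Q) {n m : R21} {M : ℝ} (hM : 0 < M)
    (hn : B n n = 0) (hm : B m m = 1) (hmn : B m n = 0)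
    (hXn : ∀ x ∈ X, B n x < 0) (hy : ∀ x ∈ X, -B x x ≤ M ^ 2 * B n x ^ 2)
    (hunb : ∀ T : ℝ, ∃ x ∈ X, T * (-B n x) ≤ B m x) :
    ∃ g ∈ Γ₀, g ≠ 1 ∧ ∃ c : ℝ, g n = c • n := by
  choose t y x hxX hy0 hyM htT htx hyx hdisj using
    fun i : ℕ => exists_nearly_highest hM hXt hXn hy hunb (i : ℝ)
  choose A hAΓ hAQ using fun i => hcob (x i) (hxX i)
  have hcpos : ∀ i, 0 < -B n (x i) := fun i => neg_pos.2 (hXn _ (hxX i))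
  set V : ℕ → R21 := fun i => (1 / (y i * -B n (x i))) • x i with hV
  have hBV : ∀ i z, B z (V i) = B z (x i) / (y i * -B n (x i)) := by
    intro i z; simp only [hV]; rw [B_smul_right]; ring
  have hsee : ∀ i, SeesFromRight X (V i) (y i • n) (m + t i • n) := by
    intro i
    have hy' := (hy0 i).ne'
    have hc' := (hcpos i).ne'
    refine ⟨⟨?_, ?_, ?_, ?_, ?_, ?_⟩, ?_, hdisj i, ⟨x i, hxX i, ?_⟩, fun T => ?_⟩
    · have h1 := hyx i
      rw [hBV, B_comm, hBV, show B (x i) (x i) = -(y i ^ 2 * (-B n (x i)) ^ 2) by linarith]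
      have hc'' := neg_ne_zero.1 hc'
      field_simp
    · rw [B_smul_left, B_smul_right, hn]; simp
    · rw [B_comm, hBV, B_smul_left, div_eq_iff (mul_ne_zero hy' hc')]; ring
    · simp only [B_add_left, B_add_right, B_smul_left, B_smul_right, hm, hn, hmn, B_comm n m]; simp
    · simp only [B_add_left, B_smul_left, B_smul_right, hn, hmn]; simp
    · rw [hBV, B_add_left, B_smul_left, htx]; simp
    · intro z hz; rw [B_smul_left]; exact mul_neg_of_pos_of_neg (hy0 i) (hXn z hz)
    · rw [B_add_left, B_smul_left, htx]; ring
    · obtain ⟨z, hz, hzT⟩ := hunb (T * y i + t i)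
      refine ⟨z, hz, ?_⟩
      rw [B_add_left, B_smul_left, B_smul_left]; linarith
  have hsee' : ∀ i, SeesFromRight X (A i (V i)) (A i (y i • n)) (A i (m + t i • n)) := fun i =>
    (hsee i).map (hB _ (hAΓ i)) (hXinv _ (hAΓ i)) (hXinv _ (Γ₀.inv_mem (hAΓ i)))
  obtain ⟨R, hR⟩ : ∃ R : ℝ, ∀ q ∈ Q, q 2 / √(-B q q) ≤ R := by
    have hcont : ContinuousOn (fun q : R21 => q 2 / √(-B q q)) Q := by
      refine ContinuousOn.div (by fun_prop)
        (Real.continuous_sqrt.comp (continuous_id.lorentz continuous_id).neg).continuousOn ?_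
      intro q hq
      have := (hXt q (hQX hq)).1
      exact (Real.sqrt_pos.2 (by linarith)).ne'
    obtain ⟨R, hR⟩ := hQ.bddAbove_image hcont
    exact ⟨R, fun q hq => hR ⟨q, hq, rfl⟩⟩
  have hAV : ∀ i, 0 < (A i (V i)) 2 ∧ (A i (V i)) 2 ≤ R := by
    intro i
    have h1 := hR _ (hAQ i)
    have h2 := (hXt _ (hQX (hAQ i))).2
    rw [hB _ (hAΓ i), hyx, ← neg_sq (B n (x i)), ← mul_pow,
      Real.sqrt_sq (mul_pos (hy0 i) (hcpos i)).le] at h1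
    have h3 : (A i (V i)) 2 = (A i (x i)) 2 / (y i * -B n (x i)) := by
      simp only [hV, map_smul, PiLp.smul_apply, smul_eq_mul]; ring
    rw [h3]
    exact ⟨div_pos h2 (mul_pos (hy0 i) (hcpos i)), h1⟩
  obtain ⟨C, hC⟩ := exists_norm_bound 1 1 R
  have hbd : ∀ i, (A i (V i), A i (y i • n), A i (m + t i • n)) ∈
      Metric.closedBall (0 : R21 × R21 × R21) C := by
    intro i
    have h := (hsee' i).frame
    have hv := hAV i
    rw [mem_closedBall_zero_iff]
    refine max_le (hC _ _ h.VV hv.1 hv.2 ?_ ?_) (max_le (hC _ _ h.VV hv.1 hv.2 ?_ ?_)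
      (hC _ _ h.VV hv.1 hv.2 ?_ ?_))
    · rw [h.VV]; norm_num
    · rw [h.VV]; norm_num
    · rw [h.Vn]; norm_num
    · rw [h.nn]; norm_num
    · rw [B_comm, h.mV]; norm_num
    · rw [h.mm]
  obtain ⟨⟨V', n', m'⟩, -, φ, hφ, hlim⟩ :=
    (isCompact_closedBall (0 : R21 × R21 × R21) C).tendsto_subseq hbd
  set Vh : ℕ → R21 := fun i => A (φ i) (V (φ i)) with hVh
  set nh : ℕ → R21 := fun i => A (φ i) (y (φ i) • n) with hnh
  set mh : ℕ → R21 := fun i => A (φ i) (m + t (φ i) • n) with hmh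
  have hs : ∀ i, SeesFromRight X (Vh i) (nh i) (mh i) := fun i => hsee' (φ i)
  have lV : Tendsto Vh atTop (𝓝 V') := (continuous_fst.tendsto _).comp hlim
  have ln : Tendsto nh atTop (𝓝 n') :=
    ((continuous_fst.comp continuous_snd).tendsto _).comp hlim
  have lm : Tendsto mh atTop (𝓝 m') :=
    ((continuous_snd.comp continuous_snd).tendsto _).comp hlim
  have hF : HoroFrame V' n' m' := by
    refine ⟨?_, ?_, ?_, ?_, ?_, ?_⟩
    · exact tendsto_nhds_unique (lV.lorentz lV) (by simp_rw [(hs _).frame.VV]; exact tendsto_const_nhds)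
    · exact tendsto_nhds_unique (ln.lorentz ln) (by simp_rw [(hs _).frame.nn]; exact tendsto_const_nhds)
    · exact tendsto_nhds_unique (lV.lorentz ln) (by simp_rw [(hs _).frame.Vn]; exact tendsto_const_nhds)
    · exact tendsto_nhds_unique (lm.lorentz lm) (by simp_rw [(hs _).frame.mm]; exact tendsto_const_nhds)
    · exact tendsto_nhds_unique (lm.lorentz ln) (by simp_rw [(hs _).frame.mn]; exact tendsto_const_nhds)
    · exact tendsto_nhds_unique (lm.lorentz lV) (by simp_rw [(hs _).frame.mV]; exact tendsto_const_nhds)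
  have l1 : ∀ {f : ℕ → R21} {a : R21}, Tendsto f atTop (𝓝 a) →
      Tendsto (fun p : ℕ × ℕ => f p.1) (atTop ×ˢ atTop) (𝓝 a) := fun h => h.comp tendsto_fst
  have l2 : ∀ {f : ℕ → R21} {a : R21}, Tendsto f atTop (𝓝 a) →
      Tendsto (fun p : ℕ × ℕ => f p.2) (atTop ×ˢ atTop) (𝓝 a) := fun h => h.comp tendsto_snd
  have hF' := hF.nullFrame
  have e1 : ∀ᶠ p : ℕ × ℕ in atTop ×ˢ atTop, |B (mh p.2) (Vh p.1 + (4 : ℝ) • nh p.1)| < 1 / 4 := by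
    have h1 := ((l2 lm).lorentz ((l1 lV).add ((l1 ln).const_smul (4 : ℝ)))).abs
    refine h1.eventually_lt_const ?_
    rw [B_add_right, B_smul_right, hF.mV, hF.mn]; norm_num
  have e2 : ∀ᶠ p : ℕ × ℕ in atTop ×ˢ atTop,
      |B (nh p.2) (Vh p.1 + (4 : ℝ) • nh p.1) + 1| < 1 / 4 := by
    have h1 := (((l2 ln).lorentz ((l1 lV).add ((l1 ln).const_smul (4 : ℝ)))).add_const 1).abs
    refine h1.eventually_lt_const ?_
    rw [B_add_right, B_smul_right, B_comm, hF.Vn, hF.nn]; norm_num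
  have ha := (((l1 lV).sub ((l1 ln).const_smul (1 / 2 : ℝ))).lorentz (l2 ln)).neg
  have ha1 : -B (V' - (1 / 2 : ℝ) • n') n' = 1 := by
    rw [B_comm, hF'.pair]; norm_num
  rw [ha1] at ha
  have e3 := ha.eventually_const_lt zero_lt_one
  have e4 := (((l1 lm).lorentz (l2 lm)).add
    (((((l1 lV).sub ((l1 ln).const_smul (1 / 2 : ℝ))).lorentz (l2 lm)).mul
      ((l1 lm).lorentz (l2 ln))).div (ha.const_mul 2) (by norm_num))).eventually_const_lt
      (u := 0) (by rw [hF.mm, hF.mn]; norm_num)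
  have e5 : ∀ᶠ p : ℕ × ℕ in atTop ×ˢ atTop, B (mh p.1) (Vh p.2) < 1 := by
    refine ((l1 lm).lorentz (l2 lV)).eventually_lt_const ?_
    rw [hF.mV]; norm_num
  have hev := (e1.and (e2.and (e3.and (e4.and e5))))
  rw [prod_atTop_atTop_eq, eventually_atTop_prod_self'] at hev
  obtain ⟨N, hN⟩ := hev
  -- The second point is at least `M` further to the right, and its height is at most `M`. If the
  -- two group elements coincided, the pairing bounded in `c5`, which tends to `0`, would be at
  -- least `1`.
  obtain ⟨K, hK⟩ := exists_nat_ge (t (φ N) + M)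
  set j := max N K with hj
  have hKt : t (φ N) + M ≤ t (φ j) := by
    refine hK.trans (le_trans ?_ (htT (φ j)))
    exact_mod_cast (le_max_right N K).trans (hφ.id_le j)
  obtain ⟨c1, c2, c3, c4, c5⟩ := hN N le_rfl j (le_max_left _ _)
  obtain ⟨d1, d2, -, -, -⟩ := hN j (le_max_left _ _) N le_rfl
  -- Neither centre lies to the right of the other; for frames this close that leaves only a common
  -- centre.
  have hpar := (hs N).frame.sign_change (hs j).frame.nn (hs j).frame.mn c3 c4
    ((hs N).not_right hX hXt (hs j) c1 c2) ((hs j).not_right hX hXt (hs N) d1 d2)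
  set a := -B (Vh N - (1 / 2 : ℝ) • nh N) (nh j) with hadef
  refine ⟨(A (φ N))⁻¹ * A (φ j), Γ₀.mul_mem (Γ₀.inv_mem (hAΓ _)) (hAΓ _), ?_,
    a * y (φ N) / y (φ j), ?_⟩
  · intro h1
    have h2 : A (φ j) = A (φ N) := (inv_mul_eq_one.1 h1).symm
    simp only [hmh, hVh] at c5
    rw [h2, hB _ (hAΓ _), hBV, B_add_left, B_smul_left, htx] at c5
    have h3 : (t (φ j) * -B n (x (φ j)) + t (φ N) * B n (x (φ j))) /
      (y (φ j) * -B n (x (φ j))) = (t (φ j) - t (φ N)) / y (φ j) := by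
      have := (hcpos (φ j)).ne'
      have := (hy0 (φ j)).ne'
      rw [div_eq_div_iff (by positivity) (by positivity)]; ring
    rw [h3, div_lt_one (hy0 _)] at c5
    have := hyM (φ j)
    linarith
  · have h1 : y (φ j) • A (φ j) n = (a * y (φ N)) • A (φ N) n := by
      simp only [hnh, map_smul] at hpar
      rw [hpar, smul_smul]
    have h2 : A (φ j) n = (a * y (φ N) / y (φ j)) • A (φ N) n := by
      rw [div_eq_inv_mul, mul_smul, ← h1, smul_smul, inv_mul_cancel₀ (hy0 _).ne', one_smul]
    rw [LinearEquiv.mul_apply, h2, map_smul]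
    congr 1
    exact (A (φ N)).symm_apply_apply n

/-! ### The Klein model and orbits of the Fuchsian group -/

/-- The direction of a vector, in the Klein model. -/
noncomputable def proj (V : R21) : Plane := !₂[V 0 / V 2, V 1 / V 2]

lemma act_eq_proj (A : R21 ≃ₗ[ℝ] R21) (p : Plane) : act A p = proj (A (lift p)) := rfl

lemma proj_smul {c : ℝ} (hc : c ≠ 0) (V : R21) : proj (c • V) = proj V := by
  ext i; fin_cases i <;> simp [proj, mul_div_mul_left _ _ hc]

lemma lift_proj {V : R21} (hV : V 2 ≠ 0) : lift (proj V) = (V 2)⁻¹ • V := by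
  ext i; fin_cases i <;> simp [proj, lift, div_eq_inv_mul, hV]

lemma proj_lift (p : Plane) : proj (lift p) = p := by
  ext i; fin_cases i <;> simp [proj, lift]

lemma act_proj (A : R21 ≃ₗ[ℝ] R21) {V : R21} (hV : V 2 ≠ 0) : act A (proj V) = proj (A V) := by
  rw [act_eq_proj, lift_proj hV, map_smul, proj_smul (inv_ne_zero hV)]

lemma norm_sq_plane (p : Plane) : ‖p‖ ^ 2 = p 0 ^ 2 + p 1 ^ 2 := by
  rw [EuclideanSpace.real_norm_sq_eq, Fin.sum_univ_two]

lemma B_lift (p : Plane) : B (lift p) (lift p) = ‖p‖ ^ 2 - 1 := by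
  rw [norm_sq_plane]; simp [B, lift]; ring

lemma futureTimelike_lift {p : Plane} (hp : p ∈ SPlus) : FutureTimelike (lift p) := by
  rw [SPlus, mem_ball_zero_iff] at hp
  refine ⟨?_, by simp [lift]⟩
  rw [B_lift]
  nlinarith [norm_nonneg p]

lemma norm_sq_proj {V : R21} (hV : V 2 ≠ 0) : ‖proj V‖ ^ 2 = 1 + B V V / V 2 ^ 2 := by
  rw [norm_sq_plane]; simp only [proj, B]; simp; field_simp; ring

lemma proj_mem_SPlus {V : R21} (hV : FutureTimelike V) : proj V ∈ SPlus := by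
  rw [SPlus, mem_ball_zero_iff]
  have h1 := norm_sq_proj hV.2.ne'
  have h2 : B V V / V 2 ^ 2 < 0 := div_neg_of_neg_of_pos hV.1 (pow_pos hV.2 2)
  nlinarith [norm_nonneg (proj V)]

section Fuchsian

variable {Γ₀ : Subgroup (R21 ≃ₗ[ℝ] R21)}

lemma IsFreeFuchsian.B_map (h : IsFreeFuchsian Γ₀) {A : R21 ≃ₗ[ℝ] R21} (hA : A ∈ Γ₀) (x y : R21) :
    B (A x) (A y) = B x y := (h.so A hA).1 x y

lemma IsFreeFuchsian.futureTimelike (h : IsFreeFuchsian Γ₀) {A : R21 ≃ₗ[ℝ] R21} (hA : A ∈ Γ₀)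
    {x : R21} (hx : FutureTimelike x) : FutureTimelike (A x) := (h.so A hA).2.2 x hx

lemma IsFreeFuchsian.B_inv (h : IsFreeFuchsian Γ₀) {A : R21 ≃ₗ[ℝ] R21} (hA : A ∈ Γ₀) (x y : R21) :
    B (A⁻¹ x) y = B x (A y) := by
  rw [← h.B_map hA (A⁻¹ x) y]; congr 1; exact A.apply_symm_apply x

lemma IsFreeFuchsian.futureNull (h : IsFreeFuchsian Γ₀) {A : R21 ≃ₗ[ℝ] R21} (hA : A ∈ Γ₀)
    {x : R21} (hx : FutureNull x) : FutureNull (A x) := by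
  have h1 : B (A x) (A x) = 0 := by rw [h.B_map hA, hx.1]
  refine ⟨h1, time_pos_of_B_neg (h.futureTimelike hA futureTimelike_basePt) h1.le ?_⟩
  rw [h.B_map hA]
  exact B_neg_of_timelike futureTimelike_basePt hx.1.le hx.2

lemma IsFreeFuchsian.eq_one_of_fixes (h : IsFreeFuchsian Γ₀) {A : R21 ≃ₗ[ℝ] R21} (hA : A ∈ Γ₀)
    {V : R21} (hV : FutureTimelike V) (hAV : A V = V) : A = 1 :=
  h.free_action A hA (proj V) (proj_mem_SPlus hV) (by rw [act_proj A hV.2.ne', hAV])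

/-- Every orbit in the hyperboloid has a point nearest to the base point. -/
lemma IsFreeFuchsian.exists_min_time (h : IsFreeFuchsian Γ₀) {V : R21} (hV : B V V = -1)
    (hV2 : 0 < V 2) : ∃ A ∈ Γ₀, ∀ A' ∈ Γ₀, (A V) 2 ≤ (A' V) 2 := by
  have hVt : FutureTimelike V := ⟨by rw [hV]; norm_num, hV2⟩
  -- The Klein norm of a point of the hyperboloid at height `V 2`, so points that are no higher
  -- project into this closed ball.
  set r := √(1 - 1 / V 2 ^ 2) with hr
  have hQ : ∀ A ∈ Γ₀, (A V) 2 ≤ V 2 → proj (A V) ∈ Metric.closedBall (0 : Plane) r := by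
    intro A hA hle
    have h1 := h.futureTimelike hA hVt
    rw [mem_closedBall_zero_iff]
    apply Real.le_sqrt_of_sq_le
    rw [norm_sq_proj h1.2.ne', h.B_map hA, hV]
    have : 1 / V 2 ^ 2 ≤ 1 / (A V) 2 ^ 2 :=
      one_div_le_one_div_of_le (pow_pos h1.2 2) (pow_le_pow_left₀ h1.2.le hle 2)
    rw [neg_div]; linarith
  have hfin := h.properly_discontinuous (Metric.closedBall (0 : Plane) r)
    (isCompact_closedBall _ _) (by
      apply Metric.closedBall_subset_ball
      rw [hr, Real.sqrt_lt' one_pos]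
      have : 0 < 1 / V 2 ^ 2 := by positivity
      linarith)
  have hfin' : {A | A ∈ Γ₀ ∧ (A V) 2 ≤ V 2}.Finite := by
    refine hfin.subset ?_
    rintro A ⟨hA, hle⟩
    refine ⟨hA, proj (A V), ⟨proj V, ?_, act_proj A hV2.ne'⟩, hQ A hA hle⟩
    exact hQ 1 Γ₀.one_mem le_rfl
  obtain ⟨A, ⟨hA, hle⟩, hmin⟩ := Set.exists_min_image _ (fun A : R21 ≃ₗ[ℝ] R21 => (A V) 2) hfin'
    ⟨1, Γ₀.one_mem, le_rfl⟩
  refine ⟨A, hA, fun A' hA' => ?_⟩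
  rcases le_total ((A' V) 2) (V 2) with h1 | h1
  · exact hmin A' ⟨hA', h1⟩
  · exact hle.trans h1

/-- The orbit graph of a finite generating system: a connected invariant set with compact quotient,
all of whose points are convex combinations of points of the orbit of the base point. -/
lemma IsFreeFuchsian.exists_connected_cocompact (h : IsFreeFuchsian Γ₀) :
    ∃ X Q : Set R21, IsPreconnected X ∧ (∀ x ∈ X, FutureTimelike x) ∧
      (∀ A ∈ Γ₀, ∀ x ∈ X, A x ∈ X) ∧ IsCompact Q ∧ Q ⊆ X ∧ (∀ x ∈ X, ∃ A ∈ Γ₀, A x ∈ Q) ∧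
      (∀ A ∈ Γ₀, A basePt ∈ X) ∧ ∀ w : R21, ∀ r : ℝ, (∀ A ∈ Γ₀, r ≤ B w (A basePt)) →
        ∀ x ∈ X, r ≤ B w x := by
  obtain ⟨k, hk, ⟨f⟩⟩ := h.free_group
  set σ : Fin k → (R21 ≃ₗ[ℝ] R21) := fun i => (f (FreeGroup.of i) : R21 ≃ₗ[ℝ] R21) with hσ
  have hσΓ : ∀ i, σ i ∈ Γ₀ := fun i => (f (FreeGroup.of i)).2
  set Q : Set R21 := ⋃ i, segment ℝ basePt (σ i basePt) with hQ
  set X : Set R21 := {x | ∃ A ∈ Γ₀, ∃ q ∈ Q, x = A q} with hX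
  have hseg : ∀ A ∈ Γ₀, ∀ i, segment ℝ (A basePt) (A (σ i basePt)) ⊆ X := by
    intro A hA i x hx
    obtain ⟨a, b, ha, hb, hab, rfl⟩ := hx
    exact ⟨A, hA, a • basePt + b • σ i basePt, Set.mem_iUnion.2 ⟨i, a, b, ha, hb, hab, rfl⟩,
      by simp⟩
  have hbase : ∀ A ∈ Γ₀, A basePt ∈ X := fun A hA =>
    hseg A hA ⟨0, by omega⟩ (left_mem_segment ℝ _ _)
  have hinv : ∀ A ∈ Γ₀, ∀ x ∈ X, A x ∈ X := by
    rintro A hA _ ⟨A', hA', q, hq, rfl⟩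
    exact ⟨A * A', Γ₀.mul_mem hA hA', q, hq, rfl⟩
  have hjmap : ∀ A ∈ Γ₀, ∀ x y, JoinedIn X x y → JoinedIn X (A x) (A y) := by
    intro A hA x y hxy
    have hc : Continuous A := A.toContinuousLinearEquiv.continuous
    exact ⟨hxy.somePath.map hc, fun t => hinv A hA _ (hxy.somePath_mem t)⟩
  have hjseg : ∀ i, ∀ q ∈ segment ℝ basePt (σ i basePt), JoinedIn X basePt q := by
    intro i q hq
    have hs := hseg 1 Γ₀.one_mem i
    exact JoinedIn.of_segment_subset
      (((convex_segment _ _).segment_subset (left_mem_segment ℝ _ _) hq).trans hs)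
  have hword : ∀ w : FreeGroup (Fin k), JoinedIn X basePt ((f w : R21 ≃ₗ[ℝ] R21) basePt) := by
    intro w
    induction w using FreeGroup.induction_on with
    | C1 => simpa using JoinedIn.refl (hbase 1 Γ₀.one_mem)
    | of i => exact hjseg i _ (right_mem_segment ℝ _ _)
    | inv_of i ih =>
      have h1 := hjmap _ (Γ₀.inv_mem (hσΓ i)) _ _ ih
      rw [show (σ i)⁻¹ (σ i basePt) = basePt from (σ i).symm_apply_apply basePt] at h1
      rw [map_inv]
      exact h1.symm
    | mul a b iha ihb =>
      have h1 := hjmap _ (f a).2 _ _ ihb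
      rw [map_mul]
      exact iha.trans h1
  have hall : ∀ A ∈ Γ₀, JoinedIn X basePt (A basePt) := by
    intro A hA
    have := hword (f.symm ⟨A, hA⟩)
    rwa [f.apply_symm_apply] at this
  have hpc : IsPathConnected X := by
    refine ⟨basePt, hbase 1 Γ₀.one_mem, ?_⟩
    rintro _ ⟨A, hA, q, hq, rfl⟩
    obtain ⟨i, hi⟩ := Set.mem_iUnion.1 hq
    exact (hall A hA).trans (hjmap A hA _ _ (hjseg i q hi))
  refine ⟨X, Q, hpc.isConnected.isPreconnected, ?_, hinv, ?_, ?_, ?_, hbase, ?_⟩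
  · rintro _ ⟨A, hA, q, hq, rfl⟩
    obtain ⟨i, a, b, ha, hb, hab, rfl⟩ := Set.mem_iUnion.1 hq
    apply h.futureTimelike hA
    have h1 := h.futureTimelike (hσΓ i) futureTimelike_basePt
    rcases ha.eq_or_lt with rfl | ha
    · have : b = 1 := by linarith
      subst this
      simpa using h1
    · refine (futureTimelike_basePt.smul ha).add ?_ ?_
      · rw [B_smul_left, B_smul_right]
        have := h1.1
        have := mul_nonneg hb hb
        nlinarith
      · have := h1.2
        simp only [PiLp.smul_apply, smul_eq_mul]
        positivity
  · refine isCompact_iUnion fun i => ?_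
    rw [segment_eq_image ℝ]
    exact isCompact_Icc.image (by fun_prop)
  · exact fun q hq => ⟨1, Γ₀.one_mem, q, hq, rfl⟩
  · rintro _ ⟨A, hA, q, hq, rfl⟩
    refine ⟨A⁻¹, Γ₀.inv_mem hA, ?_⟩
    convert hq
    exact A.symm_apply_apply q
  · rintro w r hw _ ⟨A, hA, q, hq, rfl⟩
    obtain ⟨i, a, b, ha, hb, hab, rfl⟩ := Set.mem_iUnion.1 hq
    have h1 := hw A hA
    have h2 := hw (A * σ i) (Γ₀.mul_mem hA (hσΓ i))
    rw [LinearEquiv.mul_apply] at h2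
    simp only [map_add, map_smul, B_add_right, B_smul_right]
    have h3 := mul_le_mul_of_nonneg_left h1 ha
    have h4 := mul_le_mul_of_nonneg_left h2 hb
    have h5 : r = a * r + b * r := by rw [← add_mul, hab, one_mul]
    linarith

end Fuchsian

section Fuchsian

variable {Γ₀ : Subgroup (R21 ≃ₗ[ℝ] R21)}

/-! ### Dirichlet domains at parabolic points -/

/-- The line through the base point in the null direction `n` meets the hyperboloid only at the base
point. -/
lemma basePt_fixed_of_parallel (h : IsFreeFuchsian Γ₀) {A : R21 ≃ₗ[ℝ] R21} (hA : A ∈ Γ₀)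
    {n : R21} (hn : FutureNull n) {r : ℝ} (hr : A basePt - basePt = r • n) : A basePt = basePt := by
  have h1 : A basePt = basePt + r • n := by rw [← hr]; abel
  have h2 := h.B_map hA basePt basePt
  have h3 := hn.B_neg futureTimelike_basePt
  rw [h1] at h2
  simp only [B_add_left, B_add_right, B_smul_left, B_smul_right, hn.1, B_comm basePt n] at h2
  have h4 : r * B n basePt = 0 := by linarith
  rcases mul_eq_zero.1 h4 with h5 | h5
  · rw [h1, h5]; simp
  · exact absurd h5 h3.ne

/-- In the Dirichlet domain of a parabolic element, the complement of a horodisk at its fixed point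
does not accumulate at this point. -/
lemma parabolic_strip (h : IsFreeFuchsian Γ₀) {g : R21 ≃ₗ[ℝ] R21} (hg : g ∈ Γ₀) (hg1 : g ≠ 1)
    {n m n' : R21} (hn : FutureNull n) (F : NullFrame n m n') (hgn : g n = n) {δ : ℝ}
    (hδ : 0 < δ) : ∃ C : ℝ, ∀ V : R21, B V V = -1 → 0 < V 2 → V 2 ≤ (g V) 2 → V 2 ≤ (g⁻¹ V) 2 →
      δ ≤ -B n V → B (C • n - n') V ≤ 0 := by
  have hgi := Γ₀.inv_mem hg
  have hgin : g⁻¹ n = n := by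
    conv_lhs => rw [← hgn]
    exact g.symm_apply_apply n
  set u := g basePt - basePt with hu
  set u' := g⁻¹ basePt - basePt with hu'
  have hnu : B n u = 0 := by
    rw [hu, B_sub_right, ← h.B_inv hg, hgin, sub_self]
  have hnu' : B n u' = 0 := by
    rw [hu', B_sub_right, B_comm n (g⁻¹ basePt), h.B_inv hg, hgn, B_comm, sub_self]
  obtain ⟨p, hp⟩ : ∃ p, p = B m u := ⟨_, rfl⟩
  obtain ⟨r, hr⟩ : ∃ r, r = -B n' u := ⟨_, rfl⟩
  obtain ⟨p', hp'⟩ : ∃ p, p = B m u' := ⟨_, rfl⟩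
  obtain ⟨r', hr'⟩ : ∃ r, r = -B n' u' := ⟨_, rfl⟩
  have eu : u = r • n + p • m := by
    rw [F.expand u, ← hp, ← hr, hnu]; simp
  have eu' : u' = r' • n + p' • m := by
    rw [F.expand u', ← hp', ← hr', hnu']; simp
  have hbb : B basePt basePt = -1 := by simp [B, basePt]
  have hpp : p ^ 2 = p' ^ 2 := by
    have h1 : B u u = p ^ 2 := by rw [F.B_self, ← hp, hnu]; ring
    have h2 : B u' u' = p' ^ 2 := by rw [F.B_self, ← hp', hnu']; ring
    rw [← h1, ← h2, hu, hu']
    simp only [B_sub_left, B_sub_right, h.B_map hg, h.B_map hgi, hbb]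
    rw [h.B_inv hg, B_comm basePt (g⁻¹ basePt), h.B_inv hg, B_comm (g basePt)]
  have hp0 : p ≠ 0 := by
    intro h0
    rw [h0, zero_smul, add_zero] at eu
    exact hg1 (h.eq_one_of_fixes hg futureTimelike_basePt (basePt_fixed_of_parallel h hg hn eu))
  -- Were the two components equal, `g²` would move the base point along `n`, hence fix it, and `g`
  -- would fix the time-like sum of the base point and its image.
  have hp'p : p' = -p := by
    rcases sq_eq_sq_iff_eq_or_eq_neg.1 hpp with h1 | h1
    · exfalso
      have hgu' : g u' = -u := by
        rw [hu', map_sub, show g (g⁻¹ basePt) = basePt from g.apply_symm_apply basePt, hu]; abel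
      have h2 : (g * g) basePt - basePt = (r - r') • n := by
        have h3 : g u = -u + (r - r') • n := by
          have : u = u' + (r - r') • n := by rw [eu, eu', h1]; module
          rw [this, map_add, map_smul, hgn, hgu', this]
        have h4 : (g * g) basePt - basePt = g u + u := by
          rw [hu, map_sub, LinearEquiv.mul_apply]; abel
        rw [h4, h3]; abel
      have h5 := basePt_fixed_of_parallel h (Γ₀.mul_mem hg hg) hn h2
      have h6 := h.futureTimelike hg futureTimelike_basePt
      refine hg1 (h.eq_one_of_fixes hg (futureTimelike_basePt.add h6.1.le h6.2.le) ?_)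
      rw [map_add, ← LinearEquiv.mul_apply, h5, add_comm]
    · rw [h1]; ring
  -- In half-plane coordinates the two Dirichlet inequalities give `|x| ≤ K`, and the horoball
  -- condition gives `y ≤ 1 / δ`. Since `B n' V / B n V = (x² + y²) / 2`, the constant is half the
  -- sum of the squares.
  set K := (|r| + |r'|) / |p| with hK
  refine ⟨(K ^ 2 + 1 / δ ^ 2) / 2, fun V hV hV2 h1 h2 hδV => ?_⟩
  have hVt : FutureTimelike V := ⟨by rw [hV]; norm_num, hV2⟩
  have k1 : B V u ≤ 0 := by
    have e : (g⁻¹ V) 2 = -B (g⁻¹ V) basePt := by rw [B_basePt, neg_neg]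
    have e' : V 2 = -B V basePt := by rw [B_basePt, neg_neg]
    rw [e, e', h.B_inv hg] at h2
    rw [hu, B_sub_right]; linarith
  have k2 : B V u' ≤ 0 := by
    have e : (g V) 2 = -B V (g⁻¹ basePt) := by
      rw [B_comm, h.B_inv hg, B_comm, B_basePt, neg_neg]
    have e' : V 2 = -B V basePt := by rw [B_basePt, neg_neg]
    rw [e, e'] at h1
    rw [hu', B_sub_right]; linarith
  rw [eu, B_add_right, B_smul_right, B_smul_right, B_comm V n, B_comm V m] at k1
  rw [eu', hp'p, B_add_right, B_smul_right, B_smul_right, B_comm V n, B_comm V m] at k2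
  have k3 := F.B_self V
  rw [hV] at k3
  rw [B_sub_left, B_smul_left]
  have hKK : |p| * K = |r| + |r'| := by rw [hK]; field_simp
  have hK0 : 0 ≤ K := by positivity
  generalize B n V = γ at *
  generalize B m V = b at *
  generalize B n' V = a at *
  have hγ : γ < 0 := by linarith
  have k4 : |p * b| ≤ (|r| + |r'|) * (-γ) := by
    have i1 := mul_le_mul_of_nonneg_right (le_abs_self r) (neg_nonneg.2 hγ.le)
    have i2 := mul_le_mul_of_nonneg_right (le_abs_self r') (neg_nonneg.2 hγ.le)
    have i3 := mul_nonneg (abs_nonneg r) (neg_nonneg.2 hγ.le)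
    have i4 := mul_nonneg (abs_nonneg r') (neg_nonneg.2 hγ.le)
    rw [abs_le]
    constructor <;> linarith
  have k5 : |b| ≤ K * (-γ) := by
    rw [abs_mul, ← hKK, mul_assoc] at k4
    exact le_of_mul_le_mul_left k4 (abs_pos.2 hp0)
  have k6 : b ^ 2 ≤ K ^ 2 * γ ^ 2 := by
    rw [← sq_abs b, ← neg_sq γ, ← mul_pow]
    exact pow_le_pow_left₀ (abs_nonneg b) k5 2
  have k7 : 1 ≤ 1 / δ ^ 2 * γ ^ 2 := by
    rw [div_mul_eq_mul_div, one_mul, one_le_div (by positivity), ← neg_sq γ]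
    exact pow_le_pow_left₀ hδ.le hδV 2
  have k8 : 2 * γ * a ≤ (K ^ 2 + 1 / δ ^ 2) * γ ^ 2 := by rw [add_mul]; linarith
  have k9 : (-γ) * ((K ^ 2 + 1 / δ ^ 2) / 2 * γ - a) ≤ 0 := by linarith
  exact nonpos_of_mul_nonpos_right k9 (by linarith)

/-- A null direction accumulated by the orbit of the base point which has a horoball missing the
orbit is fixed by a nontrivial element of the group. -/
lemma exists_parabolic (h : IsFreeFuchsian Γ₀) {n m n' : R21} (hn : FutureNull n)
    (F : NullFrame n m n') (hhoro : ∀ A ∈ Γ₀, 1 ≤ -B n (A basePt))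
    (hacc : ∀ C : ℝ, ∃ A ∈ Γ₀, 0 < B (C • n - n') (A basePt)) :
    ∃ g ∈ Γ₀, g ≠ 1 ∧ g n = n := by
  obtain ⟨X, Q, hX, hXt, hXinv, hQ, hQX, hcob, hbase, hhalf⟩ := h.exists_connected_cocompact
  have hXn : ∀ x ∈ X, 1 ≤ -B n x := by
    intro x hx
    have := hhalf (-n) 1 (fun A hA => by rw [B_neg_left]; exact hhoro A hA) x hx
    rwa [B_neg_left] at this
  obtain ⟨M, hM⟩ : ∃ M : ℝ, ∀ x ∈ X, -B x x ≤ M := by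
    obtain ⟨M, hM⟩ := hQ.bddAbove_image
      (f := fun q => -B q q) (continuous_id.lorentz continuous_id).neg.continuousOn
    refine ⟨M, fun x hx => ?_⟩
    obtain ⟨A, hA, hAx⟩ := hcob x hx
    rw [← h.B_map hA]
    exact hM ⟨_, hAx, rfl⟩
  have hM' : ∀ x ∈ X, -B x x ≤ (|M| + 1) ^ 2 * B n x ^ 2 := by
    intro x hx
    have h1 := hM x hx
    have h2 := hXn x hx
    have h3 := le_abs_self M
    have h4 : 1 ≤ B n x ^ 2 := by nlinarith
    have h5 : 0 ≤ |M| := abs_nonneg M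
    nlinarith
  have hkey : ∃ g ∈ Γ₀, g ≠ 1 ∧ ∃ c : ℝ, g n = c • n := by
    -- If `X` were bounded on both sides, its bounded height would confine it to a half-space away
    -- from `n`, against `hacc`.
    by_cases hr : ∀ T : ℝ, ∃ x ∈ X, T * (-B n x) ≤ B m x
    · exact exists_fixing_of_unbounded (fun A hA => h.B_map hA) hX hXt hXinv hQ hQX hcob
        (by positivity) hn.1 F.mm (by rw [B_comm]; exact F.nm)
        (fun x hx => by have := hXn x hx; linarith) hM' hr
    by_cases hl : ∀ T : ℝ, ∃ x ∈ X, T * (-B n x) ≤ B (-m) x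
    · exact exists_fixing_of_unbounded (fun A hA => h.B_map hA) hX hXt hXinv hQ hQX hcob
        (by positivity) hn.1 (by rw [B_neg_left, B_neg_right, neg_neg, F.mm])
        (by rw [B_neg_left, B_comm, F.nm, neg_zero])
        (fun x hx => by have := hXn x hx; linarith) hM' hl
    exfalso
    push Not at hr hl
    obtain ⟨T, hT⟩ := hr
    obtain ⟨T', hT'⟩ := hl
    set K := |T| + |T'| with hK
    obtain ⟨A, hA, hpos⟩ := hacc ((K ^ 2 + (|M| + 1) ^ 2) / 2)
    have hx := hbase A hA
    have h1 := hT _ hx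
    have h2 := hT' _ hx
    have h3 := hM' _ hx
    have h4 := hXn _ hx
    have h5 := F.B_self (A basePt)
    rw [B_neg_left] at h2
    rw [B_sub_left, B_smul_left] at hpos
    generalize B n (A basePt) = γ at *
    generalize B m (A basePt) = b at *
    generalize B n' (A basePt) = a at *
    have i0 : 0 ≤ -γ := by linarith
    have i1 := mul_le_mul_of_nonneg_right (le_abs_self T) i0
    have i2 := mul_le_mul_of_nonneg_right (le_abs_self T') i0
    have i3 := mul_nonneg (abs_nonneg T) i0
    have i4 := mul_nonneg (abs_nonneg T') i0
    have k5 : |b| ≤ K * (-γ) := by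
      rw [hK, add_mul, abs_le]; constructor <;> linarith
    have k6 : b ^ 2 ≤ K ^ 2 * γ ^ 2 := by
      rw [← sq_abs b, ← neg_sq γ, ← mul_pow]
      exact pow_le_pow_left₀ (abs_nonneg b) k5 2
    have k9 : 0 < (-γ) * ((K ^ 2 + (|M| + 1) ^ 2) / 2 * γ - a) := mul_pos (by linarith) hpos
    linarith
  obtain ⟨g, hg, hg1, c, hc⟩ := hkey
  refine ⟨g, hg, hg1, ?_⟩
  have hpow : ∀ (A : R21 ≃ₗ[ℝ] R21) (c : ℝ), A n = c • n → ∀ k : ℕ, (A ^ k) n = c ^ k • n := by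
    intro A c hc k
    induction k with
    | zero => simp
    | succ k ih => rw [pow_succ, LinearEquiv.mul_apply, hc, map_smul, ih, smul_smul, pow_succ, mul_comm]
  -- With `c < 1`, the powers of `A⁻¹` would push the base point into the horoball that the orbit
  -- misses. Applied to `g` and `g⁻¹`, this leaves the eigenvalue `1`.
  have hge1 : ∀ A ∈ Γ₀, ∀ c : ℝ, A n = c • n → 1 ≤ c := by
    intro A hA c hc
    have hc0 : 0 < c := by
      have := (h.futureNull hA hn).2
      rw [hc, PiLp.smul_apply, smul_eq_mul] at this
      exact pos_of_mul_pos_left this hn.2.le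
    by_contra! hlt
    obtain ⟨k, hk⟩ := exists_pow_lt_of_lt_one (x := 1 / n 2) (by have := hn.2; positivity) hlt
    have hAk := Γ₀.pow_mem hA k
    have h1 := hhoro _ (Γ₀.inv_mem hAk)
    rw [B_comm, h.B_inv hAk, hpow A c hc k, B_smul_right, B_comm, B_basePt] at h1
    rw [lt_div_iff₀ hn.2] at hk
    linarith
  have h1 := hge1 g hg c hc
  have h2 := hge1 g⁻¹ (Γ₀.inv_mem hg) c⁻¹ (by
    have h3 : g⁻¹ (g n) = n := g.symm_apply_apply n
    rw [hc, map_smul] at h3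
    rw [eq_inv_smul_iff₀ (by linarith), h3])
  have h3 : c = 1 := by
    have := mul_inv_cancel₀ (show c ≠ 0 by linarith)
    nlinarith
  rw [hc, h3, one_smul]

end Fuchsian

/-! ### Axes of hyperbolic elements and geometric finiteness -/

/-- The null vectors `α`, `β` represent the end points of the axis of a hyperbolic element of `Γ₀`,
scaled so that `α + β` is a point of the hyperboloid on the axis. -/
structure AxisPair (Γ₀ : Subgroup (R21 ≃ₗ[ℝ] R21)) (α β : R21) : Prop where
  left : FutureNull α
  right : FutureNull β
  pair : B α β = -1 / 2
  hyperbolic : ∃ A ∈ Γ₀, ∃ r : ℝ, 1 < r ∧ A α = r • α ∧ A β = r⁻¹ • β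

section AxisPair

variable {Γ₀ : Subgroup (R21 ≃ₗ[ℝ] R21)} {α β : R21}

lemma inv_apply_of_apply_eq_smul {A : R21 ≃ₗ[ℝ] R21} {x : R21} {r : ℝ} (hr : r ≠ 0)
    (h : A x = r • x) : A⁻¹ x = r⁻¹ • x := by
  have h1 : A⁻¹ (A x) = x := A.symm_apply_apply x
  rw [h, map_smul] at h1
  rw [eq_inv_smul_iff₀ hr, h1]

lemma AxisPair.symm (h : AxisPair Γ₀ α β) : AxisPair Γ₀ β α := by
  obtain ⟨A, hA, r, hr, h1, h2⟩ := h.hyperbolic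
  have hr0 : r ≠ 0 := by linarith
  refine ⟨h.right, h.left, by rw [B_comm, h.pair], A⁻¹, Γ₀.inv_mem hA, r, hr, ?_, ?_⟩
  · simpa using inv_apply_of_apply_eq_smul (inv_ne_zero hr0) h2
  · exact inv_apply_of_apply_eq_smul hr0 h1

lemma AxisPair.map (hΓ : IsFreeFuchsian Γ₀) (h : AxisPair Γ₀ α β) {A : R21 ≃ₗ[ℝ] R21}
    (hA : A ∈ Γ₀) : AxisPair Γ₀ (A α) (A β) := by
  obtain ⟨g, hg, r, hr, h1, h2⟩ := h.hyperbolic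
  refine ⟨hΓ.futureNull hA h.left, hΓ.futureNull hA h.right, by rw [hΓ.B_map hA, h.pair],
    A * g * A⁻¹, Γ₀.mul_mem (Γ₀.mul_mem hA hg) (Γ₀.inv_mem hA), r, hr, ?_, ?_⟩
  · have : A⁻¹ (A α) = α := A.symm_apply_apply α
    simp only [LinearEquiv.mul_apply, this, h1, map_smul]
  · have : A⁻¹ (A β) = β := A.symm_apply_apply β
    simp only [LinearEquiv.mul_apply, this, h2, map_smul]

lemma FutureNull.smul {n : R21} (hn : FutureNull n) {c : ℝ} (hc : 0 < c) : FutureNull (c • n) := by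
  refine ⟨by rw [B_smul_left, B_smul_right, hn.1]; ring, ?_⟩
  have := hn.2
  simp only [PiLp.smul_apply, smul_eq_mul]; positivity

lemma AxisPair.scale (h : AxisPair Γ₀ α β) {c : ℝ} (hc : 0 < c) :
    AxisPair Γ₀ (c • α) (c⁻¹ • β) := by
  obtain ⟨A, hA, r, hr, h1, h2⟩ := h.hyperbolic
  refine ⟨h.left.smul hc, h.right.smul (inv_pos.2 hc), ?_, A, hA, r, hr, ?_, ?_⟩
  · rw [B_smul_left, B_smul_right, h.pair]; field_simp
  · rw [map_smul, h1, smul_comm]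
  · rw [map_smul, h2, smul_comm]

lemma AxisPair.B_add (h : AxisPair Γ₀ α β) : B (α + β) (α + β) = -1 := by
  simp only [B_add_left, B_add_right, h.left.1, h.right.1, B_comm β α, h.pair]; norm_num

lemma AxisPair.add_pos (h : AxisPair Γ₀ α β) : 0 < (α + β) 2 := by
  have h1 := h.left.2
  have h2 := h.right.2
  simp only [PiLp.add_apply]; positivity

lemma AxisPair.timelike (h : AxisPair Γ₀ α β) : FutureTimelike (α + β) :=
  ⟨by rw [h.B_add]; norm_num, h.add_pos⟩

lemma AxisPair.exists_nullFrame (h : AxisPair Γ₀ α β) : ∃ m, NullFrame α m ((2 : ℝ) • β) :=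
  exists_nullFrame_of_pair h.left.1 (by rw [B_smul_left, B_smul_right, h.right.1]; ring)
    (by rw [B_smul_right, h.pair]; ring)

/-- The isometry preserves the plane of `n` and `n'`, hence the orthogonal line, on which it is
`±1`; the sign does not matter later. -/
lemma NullFrame.apply_normal {n m n' : R21} (F : NullFrame n m n') {A : R21 ≃ₗ[ℝ] R21}
    (hA : ∀ x y, B (A x) (A y) = B x y) {r : ℝ} (hr : r ≠ 0) (hn : A n = r • n)
    (hn' : A n' = r⁻¹ • n') : ∃ ε : ℝ, ε ^ 2 = 1 ∧ A m = ε • m := by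
  have h1 : B n (A m) = 0 := by
    have := hA n m
    rw [hn, B_smul_left, F.nm] at this
    exact (mul_eq_zero.1 this).resolve_left hr
  have h2 : B n' (A m) = 0 := by
    have := hA n' m
    rw [hn', B_smul_left, B_comm n' m, F.mn'] at this
    exact (mul_eq_zero.1 this).resolve_left (inv_ne_zero hr)
  have h3 := F.expand (A m)
  rw [h1, h2] at h3
  refine ⟨B m (A m), ?_, by simpa using h3⟩
  have h4 := F.B_self (A m)
  rw [hA, F.mm, h1] at h4
  linarith

/-- The fixed points of hyperbolic elements are accumulated by orbits. -/
lemma AxisPair.B_nonpos (hΓ : IsFreeFuchsian Γ₀) (h : AxisPair Γ₀ α β) {w : R21}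
    (hw : ∀ A ∈ Γ₀, B w (A basePt) ≤ 0) : B w α ≤ 0 := by
  obtain ⟨m, F⟩ := h.exists_nullFrame
  obtain ⟨A, hA, r, hr, h1, h2⟩ := h.hyperbolic
  have hr0 : r ≠ 0 := by linarith
  obtain ⟨ε, hε, hm⟩ := F.apply_normal (fun x y => hΓ.B_map hA x y) hr0 h1
    (by rw [map_smul, h2, smul_comm])
  have hp1 : ∀ k : ℕ, (A ^ k) α = r ^ k • α := by
    intro k
    induction k with
    | zero => simp
    | succ k ih => rw [pow_succ, LinearEquiv.mul_apply, h1, map_smul, ih, smul_smul, pow_succ, mul_comm]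
  have hp2 : ∀ k : ℕ, (A ^ k) β = r⁻¹ ^ k • β := by
    intro k
    induction k with
    | zero => simp
    | succ k ih => rw [pow_succ, LinearEquiv.mul_apply, h2, map_smul, ih, smul_smul, pow_succ, mul_comm]
  have hp3 : ∀ k : ℕ, (A ^ k) m = ε ^ k • m := by
    intro k
    induction k with
    | zero => simp
    | succ k ih => rw [pow_succ, LinearEquiv.mul_apply, hm, map_smul, ih, smul_smul, pow_succ, mul_comm]
  have he := F.expand basePt
  have hx : 0 < -B ((2 : ℝ) • β) basePt := by
    rw [B_smul_left]; have := h.right.B_neg futureTimelike_basePt; linarith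
  by_contra! hpos
  set x := -B ((2 : ℝ) • β) basePt with hxdef
  set z := B m basePt with hz
  set y := -B α basePt with hy
  -- In the image of the base point under `A ^ k` the `α`-component grows like `r ^ k` while the
  -- others stay bounded, so `B w α > 0` would eventually dominate.
  obtain ⟨k, hk⟩ := pow_unbounded_of_one_lt ((|z * B w m| + |y * 2 * B w β|) / (x * B w α)) hr
  have hAk := hw _ (Γ₀.pow_mem hA k)
  rw [he, map_add, map_add, map_smul, map_smul, map_smul, map_smul, hp1, hp2, hp3] at hAk
  simp only [B_add_right, B_smul_right] at hAk
  rw [div_lt_iff₀ (mul_pos hx hpos)] at hk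
  have hεk : |ε ^ k| = 1 := by
    rw [abs_pow, (pow_eq_one_iff_of_nonneg (abs_nonneg ε) two_ne_zero).1 (by rw [sq_abs, hε]),
      one_pow]
  have i1 : -|z * B w m| ≤ z * (ε ^ k * B w m) := by
    have : z * (ε ^ k * B w m) = ε ^ k * (z * B w m) := by ring
    rw [this]
    have := neg_abs_le (ε ^ k * (z * B w m))
    rwa [abs_mul, hεk, one_mul] at this
  have i2 : -|y * 2 * B w β| ≤ y * (2 * (r⁻¹ ^ k * B w β)) := by
    have : y * (2 * (r⁻¹ ^ k * B w β)) = r⁻¹ ^ k * (y * 2 * B w β) := by ring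
    rw [this]
    have h3 := neg_abs_le (r⁻¹ ^ k * (y * 2 * B w β))
    have h4 : |r⁻¹ ^ k * (y * 2 * B w β)| ≤ |y * 2 * B w β| := by
      rw [abs_mul]
      refine mul_le_of_le_one_left (abs_nonneg _) ?_
      rw [abs_of_pos (by positivity)]
      exact pow_le_one₀ (by positivity) (inv_le_one_of_one_le₀ hr.le)
    linarith
  linarith

end AxisPair

/-- Geometric finiteness: outside the horodisks, the axes of the hyperbolic elements stay at
bounded distance from the orbit of the base point. -/
theorem exists_thick_axis_bound {Γ₀ : Subgroup (R21 ≃ₗ[ℝ] R21)} (hΓ : IsFreeFuchsian Γ₀)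
    {N : Set R21} (hN : IsCuspFamily Γ₀ N) :
    ∃ R : ℝ, ∀ α β, AxisPair Γ₀ α β → (∀ n ∈ N, 1 ≤ -B n (α + β)) →
      ∃ A ∈ Γ₀, (A (α + β)) 2 ≤ R := by
  by_contra! hcon
  have hseq : ∀ j : ℕ, ∃ V : R21, B V V = -1 ∧ 0 < V 2 ∧ (j : ℝ) < V 2 ∧
      (∀ A ∈ Γ₀, V 2 ≤ (A V) 2) ∧ (∀ n ∈ N, 1 ≤ -B n V) ∧
      ∀ w : R21, (∀ A ∈ Γ₀, B w (A basePt) ≤ 0) → B w V ≤ 0 := by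
    intro j
    obtain ⟨α, β, hab, hthick, hlarge⟩ := hcon j
    obtain ⟨A, hA, hmin⟩ := hΓ.exists_min_time hab.B_add hab.add_pos
    have hab' := hab.map hΓ hA
    rw [map_add] at hmin
    refine ⟨A α + A β, hab'.B_add, hab'.add_pos, ?_, ?_, ?_, ?_⟩
    · rw [← map_add]; exact hlarge A hA
    · intro A' hA'
      have := hmin (A' * A) (Γ₀.mul_mem hA' hA)
      rwa [LinearEquiv.mul_apply, map_add] at this
    · intro n hn
      have := hthick _ (hN.invariant _ (Γ₀.inv_mem hA) n hn)
      rwa [hΓ.B_inv hA, map_add] at this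
    · intro w hw
      rw [B_add_right]
      have := hab'.B_nonpos hΓ hw
      have := hab'.symm.B_nonpos hΓ hw
      linarith
  choose V hVV hV2 hVj hVmin hVN hVw using hseq
  -- Normalised to height `1`, the escaping points accumulate at a vector that is null because the
  -- heights tend to infinity.
  set u : ℕ → R21 := fun j => (V j 2)⁻¹ • V j with hu
  have hBu : ∀ w j, B w (u j) = (V j 2)⁻¹ * B w (V j) := fun w j => by
    simp only [hu]; rw [B_smul_right]
  have hu2 : ∀ j, u j 2 = 1 := fun j => by
    simp only [hu, PiLp.smul_apply, smul_eq_mul]; exact inv_mul_cancel₀ (hV2 j).ne'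
  have huu : ∀ j, B (u j) (u j) = -((V j 2)⁻¹) ^ 2 := fun j => by
    rw [hBu, B_comm, hBu, hVV]; ring
  have hbd : ∀ j, u j ∈ Metric.closedBall (0 : R21) 2 := by
    intro j
    rw [mem_closedBall_zero_iff]
    refine le_of_sq_le_sq ?_ (by norm_num)
    rw [norm_sq_eq_B, huu, hu2]
    nlinarith [sq_nonneg ((V j 2)⁻¹)]
  obtain ⟨n, -, φ, hφ, hlim⟩ := (isCompact_closedBall (0 : R21) 2).tendsto_subseq hbd
  have hn2 : n 2 = 1 := by
    have h1 : Tendsto (fun j => (u (φ j)) 2) atTop (𝓝 (n 2)) :=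
      ((by fun_prop : Continuous fun x : R21 => x 2).tendsto n).comp hlim
    simp_rw [hu2] at h1
    exact tendsto_nhds_unique h1 tendsto_const_nhds
  have hinv : Tendsto (fun j => (V j 2)⁻¹) atTop (𝓝 0) :=
    tendsto_inv_atTop_zero.comp
      (tendsto_atTop_mono (fun j => (hVj j).le) tendsto_natCast_atTop_atTop)
  have hnn : B n n = 0 := by
    have h1 := hlim.lorentz hlim
    have h2 : Tendsto (fun j => B (u (φ j)) (u (φ j))) atTop (𝓝 0) := by
      simp_rw [huu]
      have := ((hinv.comp hφ.tendsto_atTop).pow 2).neg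
      simpa using this
    exact tendsto_nhds_unique h1 h2
  have hn : FutureNull n := ⟨hnn, by rw [hn2]; norm_num⟩
  obtain ⟨m, n', F, hn'⟩ := hn.exists_nullFrame
  -- The minimality of the height of `V j` in its orbit turns, in the limit, into a horoball at `n`
  -- missing the orbit of the base point.
  have hhoro : ∀ A ∈ Γ₀, 1 ≤ -B n (A basePt) := by
    intro A hA
    have h1 : Tendsto (fun j => -B (u (φ j)) (A basePt)) atTop (𝓝 (-B n (A basePt))) :=
      (hlim.lorentz tendsto_const_nhds).neg
    refine ge_of_tendsto' h1 fun j => ?_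
    have h2 := hVmin (φ j) _ (Γ₀.inv_mem hA)
    rw [B_comm, hBu, B_comm, ← hΓ.B_inv hA, B_basePt]
    have := hV2 (φ j)
    rw [mul_neg, neg_neg, inv_mul_eq_div, one_le_div this]
    exact h2
  -- `B (C • n - n') n = 1`, so no half-space of this kind contains points converging to `n`. This
  -- is used twice: for the accumulation of the orbit at `n`, and against the strip at the cusp.
  have hclosed : ∀ C : ℝ, (∀ j, B (C • n - n') (V j) ≤ 0) → False := by
    intro C hC
    have h1 := (tendsto_const_nhds (x := C • n - n')).lorentz hlim
    have h2 : B (C • n - n') n ≤ 0 := by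
      refine le_of_tendsto' h1 fun j => ?_
      show B (C • n - n') (u (φ j)) ≤ 0
      rw [hBu]
      exact mul_nonpos_of_nonneg_of_nonpos (inv_pos.2 (hV2 _)).le (hC _)
    rw [B_sub_left, B_smul_left, hnn, B_comm, F.pair] at h2
    linarith
  obtain ⟨g, hg, hg1, hgn⟩ := exists_parabolic hΓ hn F hhoro (by
    intro C
    by_contra! hC
    exact hclosed C fun j => hVw j _ hC)
  obtain ⟨r, hr, hrN⟩ := hN.all_cusps g hg hg1 n hn hgn
  obtain ⟨C, hC⟩ := parabolic_strip hΓ hg hg1 hn F hgn (one_div_pos.2 hr)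
  refine hclosed C fun j => hC (V j) (hVV j) (hV2 j) (hVmin j g hg)
    (hVmin j _ (Γ₀.inv_mem hg)) ?_
  have := hVN j _ hrN
  rw [B_smul_left] at this
  rw [div_le_iff₀ hr]
  linarith

/-! ### Equivariant forms on the time-like cone -/

/-- The differential of `proj`. -/
noncomputable def dproj (V W : R21) : Plane :=
  !₂[(W 0 * V 2 - V 0 * W 2) / V 2 ^ 2, (W 1 * V 2 - V 1 * W 2) / V 2 ^ 2]

/-- The pullback of a form on the Klein disk to the cone of time-like vectors. -/
noncomputable def coneForm (η : Plane → Plane →L[ℝ] R21) (V W : R21) : R21 :=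
  η (proj V) (dproj V W)

lemma hasDerivAt_proj {V : ℝ → R21} {W : R21} {t : ℝ} (h : HasDerivAt V W t)
    (h2 : V t 2 ≠ 0) : HasDerivAt (fun r => proj (V r)) (dproj (V t) W) t := by
  have hc : ∀ i, HasDerivAt (fun r => V r i) (W i) t := fun i => by
    exact (EuclideanSpace.proj i : R21 →L[ℝ] ℝ).hasFDerivAt.comp_hasDerivAt t h
  have hp : HasDerivAt (fun r => ![V r 0 / V r 2, V r 1 / V r 2])
      ![(W 0 * V t 2 - V t 0 * W 2) / V t 2 ^ 2, (W 1 * V t 2 - V t 1 * W 2) / V t 2 ^ 2] t := by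
    rw [hasDerivAt_pi]
    intro i
    fin_cases i
    · exact (hc 0).div (hc 2) h2
    · exact (hc 1).div (hc 2) h2
  exact (PiLp.continuousLinearEquiv 2 ℝ
    (fun _ : Fin 2 => ℝ)).symm.toContinuousLinearMap.hasFDerivAt.comp_hasDerivAt t hp

lemma hasDerivAt_line (V W : R21) (t : ℝ) : HasDerivAt (fun r : ℝ => V + r • W) W t := by
  simpa using ((hasDerivAt_id t).smul_const W).const_add V

lemma eventually_line_timelike {V : R21} (hV : FutureTimelike V) (W : R21) :
    ∀ᶠ r : ℝ in 𝓝 0, FutureTimelike (V + r • W) := by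
  have h : Tendsto (fun r : ℝ => V + r • W) (𝓝 0) (𝓝 V) := by
    have : Continuous fun r : ℝ => V + r • W := by fun_prop
    simpa using this.tendsto 0
  exact h (isOpen_futureTimelike.mem_nhds hV)

section Form

variable {η : Plane → Plane →L[ℝ] R21}

lemma hasDerivAt_section {s : Plane → R21} (hs : ∀ p ∈ SPlus, HasFDerivAt s (η p) p)
    {V : ℝ → R21} {W : R21} {t : ℝ} (h : HasDerivAt V W t) (hV : FutureTimelike (V t)) :
    HasDerivAt (fun r => s (proj (V r))) (coneForm η (V t) W) t :=
  (hs _ (proj_mem_SPlus hV)).comp_hasDerivAt t (hasDerivAt_proj h hV.2.ne')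

/-- Differentiate `s ∘ act g.linear = g ∘ s` along a line through `V`. -/
lemma coneForm_equivariant {s : Plane → R21} (hs : ∀ p ∈ SPlus, HasFDerivAt s (η p) p)
    {g : R21 ≃ᵃ[ℝ] R21} (hg : ∀ p ∈ SPlus, s (act g.linear p) = g (s p))
    (hfut : ∀ x, FutureTimelike x → FutureTimelike (g.linear x)) {V : R21}
    (hV : FutureTimelike V) (W : R21) :
    coneForm η (g.linear V) (g.linear W) = g.linear (coneForm η V W) := by
  set A := g.linear with hA
  have h1 : HasDerivAt (fun r : ℝ => s (proj (A V + r • A W))) (coneForm η (A V) (A W)) 0 := by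
    have := hasDerivAt_section hs (hasDerivAt_line (A V) (A W) 0) (by simpa using hfut V hV)
    simpa using this
  have h2 : HasDerivAt (fun r : ℝ => g (s (proj (V + r • W)))) (A (coneForm η V W)) 0 := by
    have h3 := hasDerivAt_section hs (hasDerivAt_line V W 0) (by simpa using hV)
    have h4 := (A.toContinuousLinearEquiv.toContinuousLinearMap.hasFDerivAt.comp_hasDerivAt 0
      h3).add_const (g 0)
    have h5 : (fun r : ℝ => g (s (proj (V + r • W)))) =
        fun r => A.toContinuousLinearEquiv.toContinuousLinearMap (s (proj (V + r • W))) + g 0 := by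
      funext r
      have := g.map_vadd 0 (s (proj (V + r • W)))
      simpa using this
    rw [h5]
    simpa using h4
  refine h1.unique (h2.congr_of_eventuallyEq ?_)
  filter_upwards [eventually_line_timelike hV W] with r hr
  rw [← hg _ (proj_mem_SPlus hr), act_proj _ hr.2.ne', map_add, map_smul]

lemma proj_mem_horodisk_iff {n V : R21} (hV : FutureTimelike V) :
    proj V ∈ horodisk n ↔ -B n V < √(-B V V) := by
  have hc := inv_pos.2 hV.2
  have h1 : proj V ∈ horodisk n ↔
      -B n (lift (proj V)) < √(-B (lift (proj V)) (lift (proj V))) :=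
    ⟨fun h => h.2, fun h => ⟨proj_mem_SPlus hV, h⟩⟩
  rw [h1, lift_proj hV.2.ne', B_smul_right, B_smul_right, B_smul_left]
  rw [show -((V 2)⁻¹ * ((V 2)⁻¹ * B V V)) = ((V 2)⁻¹) ^ 2 * (-B V V) by ring,
    Real.sqrt_mul (sq_nonneg _), Real.sqrt_sq hc.le, ← mul_neg]
  exact mul_lt_mul_iff_right₀ hc

lemma proj_mem_horodisk_iff_of_unit {n V : R21} (hV : B V V = -1) (h2 : 0 < V 2) :
    proj V ∈ horodisk n ↔ -B n V < 1 := by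
  rw [proj_mem_horodisk_iff ⟨by rw [hV]; norm_num, h2⟩, hV]; norm_num

/-- The differential of the horizontal coordinate, on the cone of time-like vectors. -/
noncomputable def cuspDiff (n m V W : R21) : ℝ :=
  (B m V * B n W - B m W * B n V) / B n V ^ 2

lemma cuspCoord_proj {n m V : R21} (hV : V 2 ≠ 0) : cuspCoord n m (proj V) = -B m V / B n V := by
  rw [cuspCoord, lift_proj hV, B_smul_right, B_smul_right, ← mul_neg,
    mul_div_mul_left _ _ (inv_ne_zero hV)]

lemma fderiv_cuspCoord {n m V : R21} (hn : FutureNull n) (hV : FutureTimelike V) (W : R21) :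
    fderiv ℝ (cuspCoord n m) (proj V) (dproj V W) = cuspDiff n m V W := by
  have hd : DifferentiableAt ℝ (cuspCoord n m) (proj V) := by
    have h0 : B n (lift (proj V)) ≠ 0 :=
      (hn.B_neg (futureTimelike_lift (proj_mem_SPlus hV))).ne
    unfold cuspCoord
    have hB : ∀ w : R21, DifferentiableAt ℝ (fun p : Plane => B w (lift p)) (proj V) := fun w => by
      simp only [B, lift]; simp; fun_prop
    simp only [div_eq_mul_inv]
    exact (hB m).fun_neg.fun_mul ((hB n).fun_inv h0)
  have h1 : HasDerivAt (fun r : ℝ => cuspCoord n m (proj (V + r • W)))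
      (fderiv ℝ (cuspCoord n m) (proj V) (dproj V W)) 0 := by
    have h2 := hasDerivAt_proj (hasDerivAt_line V W 0) (by simpa using hV.2.ne')
    simp only [zero_smul, add_zero] at h2
    have hd' : HasFDerivAt (cuspCoord n m) (fderiv ℝ (cuspCoord n m) (proj V))
      (proj (V + (0 : ℝ) • W)) := by simpa using hd.hasFDerivAt
    exact hd'.comp_hasDerivAt 0 h2
  have hlin : ∀ w : R21, HasDerivAt (fun r : ℝ => B w V + r * B w W) (B w W) 0 := fun w => by
    simpa using ((hasDerivAt_id (0 : ℝ)).mul_const (B w W)).const_add (B w V)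
  have h3 := (hlin m).neg.div (hlin n) (by simpa using (hn.B_neg hV).ne)
  have h4 : HasDerivAt (fun r : ℝ => cuspCoord n m (proj (V + r • W))) (cuspDiff n m V W) 0 := by
    have h5 : (-B m W * (B n V + 0 * B n W) - -(B m V + 0 * B m W) * B n W) /
        (B n V + 0 * B n W) ^ 2 = cuspDiff n m V W := by
      rw [cuspDiff]; ring
    rw [← h5]
    refine h3.congr_of_eventuallyEq ?_
    filter_upwards [eventually_line_timelike hV W] with r hr
    rw [cuspCoord_proj hr.2.ne', B_add_right, B_smul_right, B_add_right, B_smul_right]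
    rfl
  exact h1.unique h4

lemma continuousOn_coneForm (hη : ContinuousOn η SPlus) :
    ContinuousOn (fun p : R21 × R21 => coneForm η p.1 p.2)
      {p : R21 × R21 | FutureTimelike p.1} := by
  have h0 : ∀ p ∈ {p : R21 × R21 | FutureTimelike p.1}, p.1 2 ≠ 0 := fun p hp => hp.2.ne'
  have hproj : ContinuousOn (fun p : R21 × R21 => proj p.1) {p : R21 × R21 | FutureTimelike p.1} := by
    have : ContinuousOn (fun p : R21 × R21 => ![p.1 0 / p.1 2, p.1 1 / p.1 2])
        {p : R21 × R21 | FutureTimelike p.1} := by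
      rw [continuousOn_pi]
      intro i
      fin_cases i
      · exact ContinuousOn.div (by fun_prop) (by fun_prop) h0
      · exact ContinuousOn.div (by fun_prop) (by fun_prop) h0
    exact (PiLp.continuous_toLp 2 _).comp_continuousOn this
  have hdproj : ContinuousOn (fun p : R21 × R21 => dproj p.1 p.2)
      {p : R21 × R21 | FutureTimelike p.1} := by
    have : ContinuousOn (fun p : R21 × R21 => ![(p.2 0 * p.1 2 - p.1 0 * p.2 2) / p.1 2 ^ 2,
        (p.2 1 * p.1 2 - p.1 1 * p.2 2) / p.1 2 ^ 2]) {p : R21 × R21 | FutureTimelike p.1} := by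
      rw [continuousOn_pi]
      intro i
      fin_cases i
      · exact ContinuousOn.div (by fun_prop) (by fun_prop) fun p hp => pow_ne_zero 2 (h0 p hp)
      · exact ContinuousOn.div (by fun_prop) (by fun_prop) fun p hp => pow_ne_zero 2 (h0 p hp)
    exact (PiLp.continuous_toLp 2 _).comp_continuousOn this
  exact (hη.comp hproj fun p hp => proj_mem_SPlus hp).clm_apply hdproj

/-- A standard cusp form on the closure of its horodisk. -/
lemma coneForm_eq_of_standard (hη : ContinuousOn η SPlus) {n m : R21} {k : ℝ} (hn : FutureNull n)
    (h : ∀ p ∈ horodisk n, ∀ u : Plane, η p u = (fderiv ℝ (cuspCoord n m) p u) • (k • n))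
    {V : R21} (hV : B V V = -1) (hV2 : 0 < V 2) (hVn : -B n V ≤ 1) (W : R21) :
    coneForm η V W = cuspDiff n m V W • (k • n) := by
  have hVt : FutureTimelike V := ⟨by rw [hV]; norm_num, hV2⟩
  -- Adding `ε • n` keeps `B n` fixed and makes `-B V V` larger, which moves `V` strictly into the
  -- open horodisk; then let `ε → 0`.
  have hin : ∀ ε : ℝ, 0 < ε → FutureTimelike (V + ε • n) ∧
      coneForm η (V + ε • n) W = cuspDiff n m (V + ε • n) W • (k • n) := by
    intro ε hε
    have hn' := hn.smul hε
    have ht := hVt.add hn'.1.le hn'.2.le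
    refine ⟨ht, ?_⟩
    rw [coneForm, h, fderiv_cuspCoord hn ht]
    rw [proj_mem_horodisk_iff ht]
    have h1 : B n (V + ε • n) = B n V := by rw [B_add_right, B_smul_right, hn.1]; ring
    have h2 : B (V + ε • n) (V + ε • n) = -1 + 2 * ε * B n V := by
      simp only [B_add_left, B_add_right, B_smul_left, B_smul_right, hn.1, hV, B_comm V n]; ring
    have h3 := hn.B_neg hVt
    rw [h1]
    refine lt_of_le_of_lt hVn (Real.lt_sqrt_of_sq_lt ?_)
    rw [h2]
    have := mul_pos hε (neg_pos.2 h3)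
    linarith
  have hline : Tendsto (fun ε : ℝ => V + ε • n) (𝓝[>] 0) (𝓝 V) := by
    have : Continuous fun r : ℝ => V + r • n := by fun_prop
    simpa using (this.tendsto 0).mono_left nhdsWithin_le_nhds
  have hl1 : Tendsto (fun ε : ℝ => coneForm η (V + ε • n) W) (𝓝[>] 0) (𝓝 (coneForm η V W)) := by
    have h1 := continuousOn_coneForm hη (V, W) hVt
    have h3 : Tendsto (fun ε : ℝ => ((V + ε • n, W) : R21 × R21)) (𝓝[>] 0)
        (𝓝[{p : R21 × R21 | FutureTimelike p.1}] (V, W)) := by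
      refine tendsto_nhdsWithin_iff.2 ⟨hline.prodMk_nhds tendsto_const_nhds, ?_⟩
      filter_upwards [self_mem_nhdsWithin] with ε hε using (hin ε hε).1
    exact Tendsto.comp (f := fun ε : ℝ => ((V + ε • n, W) : R21 × R21))
      (g := fun p : R21 × R21 => coneForm η p.1 p.2) h1 h3
  have hl2 : Tendsto (fun ε : ℝ => cuspDiff n m (V + ε • n) W • (k • n)) (𝓝[>] 0)
      (𝓝 (cuspDiff n m V W • (k • n))) := by
    have h1 : ∀ w : R21, Tendsto (fun ε : ℝ => B w (V + ε • n)) (𝓝[>] 0) (𝓝 (B w V)) :=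
      fun w => tendsto_const_nhds.lorentz hline
    have h2 : Tendsto (fun ε : ℝ => cuspDiff n m (V + ε • n) W) (𝓝[>] 0)
        (𝓝 (cuspDiff n m V W)) :=
      (((h1 m).mul_const (B n W)).sub ((h1 n).const_mul (B m W))).div
        ((h1 n).pow 2) (pow_ne_zero 2 (hn.B_neg hVt).ne)
    exact h2.smul_const (k • n)
  refine tendsto_nhds_unique hl1 (hl2.congr' ?_)
  filter_upwards [self_mem_nhdsWithin] with ε hε using ((hin ε hε).2).symm

end Form

/-! ### Uniform bound of the form along axes -/

/-- If a boundary point of one horodisk lay in another open one, a small push along `n` would enter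
the first without leaving the second, against disjointness. -/
lemma IsCuspFamily.boundary_thick {Γ₀ : Subgroup (R21 ≃ₗ[ℝ] R21)} {N : Set R21}
    (hN : IsCuspFamily Γ₀ N) {n : R21} (hn : n ∈ N) {V : R21} (hV : B V V = -1) (hV2 : 0 < V 2)
    (hVn : -B n V = 1) {n' : R21} (hn' : n' ∈ N) : 1 ≤ -B n' V := by
  rcases eq_or_ne n n' with rfl | hne
  · exact hVn.ge
  by_contra! hlt
  have hVt : FutureTimelike V := ⟨by rw [hV]; norm_num, hV2⟩
  have hn0 := hN.null n hn
  set b := -B n' n with hb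
  have hb0 : 0 ≤ b := by
    have := B_nonpos (hN.null n' hn').1.le hn0.1.le (hN.null n' hn').2.le hn0.2.le
    linarith
  set ε := (1 + B n' V) / (2 * (b + 1)) with hε
  have hε0 : 0 < ε := div_pos (by linarith) (by linarith)
  have hεb : ε * b < 1 + B n' V := by
    have h1 : ε * (2 * (b + 1)) = 1 + B n' V := by rw [hε]; field_simp
    have h2 : 0 ≤ ε * b := mul_nonneg hε0.le hb0
    linarith
  have hs := hn0.smul hε0
  have ht := hVt.add hs.1.le hs.2.le
  have hq : B (V + ε • n) (V + ε • n) = -1 - 2 * ε := by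
    simp only [B_add_left, B_add_right, B_smul_left, B_smul_right, hn0.1, hV, B_comm V n]
    rw [show B n V = -1 by linarith]; ring
  have hsq : 1 < √(-B (V + ε • n) (V + ε • n)) := by
    rw [hq, Real.lt_sqrt (by norm_num)]; linarith
  refine Set.disjoint_left.1 (hN.disjoint n hn n' hn' hne)
    ((proj_mem_horodisk_iff ht).2 ?_) ((proj_mem_horodisk_iff ht).2 ?_)
  · rw [B_add_right, B_smul_right, hn0.1]; linarith
  · rw [B_add_right, B_smul_right]; linarith

lemma cuspDiff_tangent {n m V : R21} (hn : B n n = 0) (hm : B m m = 1) (hmn : B m n = 0)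
    (hVn : -B n V = 1) : cuspDiff n m V (m + B m V • n) = 1 := by
  have h1 : B n V = -1 := by linarith
  rw [cuspDiff, B_add_right, B_smul_right, B_add_right, B_smul_right, hn, hm, B_comm n m, hmn, h1]
  norm_num

/-- The form `dx` has hyperbolic norm `y = 1 / (-B n V)`: `m'` is the unit tangent of the horocycle
through `V`, and Cauchy-Schwarz applies in the tangent plane. -/
lemma abs_cuspDiff_le {n m V W : R21} (hn : FutureNull n) (hm : B m m = 1) (hmn : B m n = 0)
    (hV : B V V = -1) (hV2 : 0 < V 2) (hVW : B V W = 0) (hW : B W W = 1) :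
    |cuspDiff n m V W| * -B n V ≤ 1 := by
  have hVt : FutureTimelike V := ⟨by rw [hV]; norm_num, hV2⟩
  have hneg := hn.B_neg hVt
  set m' := m - (B m V / B n V) • n with hm'
  have h1 : B V m' = 0 := by
    rw [hm', B_sub_right, B_smul_right, B_comm V m, B_comm V n,
      div_mul_cancel₀ _ hneg.ne, sub_self]
  have h2 : B m' m' = 1 := by
    rw [hm']
    simp only [B_sub_left, B_sub_right, B_smul_left, B_smul_right, hm, hmn, B_comm n m, hn.1]
    ring
  have h3 := sq_B_le hVt h1 hVW
  rw [h2, hW, one_mul] at h3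
  have h4 : cuspDiff n m V W * -B n V = B m' W := by
    rw [cuspDiff, hm', B_sub_left, B_smul_left]
    have := hneg.ne
    field_simp; ring
  have h5 : |cuspDiff n m V W| * -B n V = |B m' W| := by
    rw [← h4, abs_mul, abs_of_pos (neg_pos.2 hneg)]
  rw [h5]
  exact abs_le_one_iff_mul_self_le_one.2 (by nlinarith)

/-- The unit tangent vectors over a bounded piece of the hyperboloid form a compact set. -/
lemma exists_compact_form_bound {η : Plane → Plane →L[ℝ] R21} (hη : ContinuousOn η SPlus) (R : ℝ) :
    ∃ C : ℝ, 0 ≤ C ∧ ∀ V W : R21, B V V = -1 → 0 < V 2 → V 2 ≤ R → B V W = 0 → B W W = 1 →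
      |B (coneForm η V W) (V + W)| ≤ C := by
  set K : Set (R21 × R21) := {p | B p.1 p.1 = -1 ∧ 0 ≤ p.1 2 ∧ p.1 2 ≤ R ∧ B p.1 p.2 = 0 ∧
    B p.2 p.2 = 1} with hK
  have htime : ∀ V : R21, B V V = -1 → 0 ≤ V 2 → 0 < V 2 := by
    intro V hV h0
    refine lt_of_le_of_ne h0 fun h => ?_
    simp only [B, ← h] at hV
    nlinarith [sq_nonneg (V 0), sq_nonneg (V 1)]
  have hKt : ∀ p ∈ K, FutureTimelike p.1 := fun p hp => ⟨by rw [hp.1]; norm_num, htime _ hp.1 hp.2.1⟩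
  have hKc : IsCompact K := by
    refine Metric.isCompact_of_isClosed_isBounded ?_ ?_
    · refine (isClosed_eq (continuous_fst.lorentz continuous_fst) continuous_const).inter
        ((isClosed_le continuous_const (g := fun p : R21 × R21 => p.1 2) (by fun_prop)).inter
        ((isClosed_le (f := fun p : R21 × R21 => p.1 2) (by fun_prop) continuous_const).inter
        ((isClosed_eq (continuous_fst.lorentz continuous_snd) continuous_const).inter
        (isClosed_eq (continuous_snd.lorentz continuous_snd) continuous_const))))
    · obtain ⟨C, hC⟩ := exists_norm_bound 1 1 R
      refine isBounded_iff_forall_norm_le.2 ⟨C, fun p hp => max_le ?_ ?_⟩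
      · exact hC p.1 p.1 hp.1 (hKt p hp).2 hp.2.2.1 (by rw [hp.1]; norm_num)
          (by rw [hp.1]; norm_num)
      · exact hC p.1 p.2 hp.1 (hKt p hp).2 hp.2.2.1 (by rw [hp.2.2.2.1]; norm_num)
          (by rw [hp.2.2.2.2])
  have hcont : ContinuousOn (fun p : R21 × R21 => |B (coneForm η p.1 p.2) (p.1 + p.2)|) K := by
    have h1 := (continuousOn_coneForm hη).mono hKt
    exact (continuous_B.comp_continuousOn
      (h1.prodMk (continuous_fst.add continuous_snd).continuousOn)).abs
  obtain ⟨C, hC⟩ := hKc.bddAbove_image hcont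
  exact ⟨|C|, abs_nonneg C, fun V W h1 h2 h3 h4 h5 =>
    (hC ⟨(V, W), ⟨h1, h2.le, h3, h4, h5⟩, rfl⟩).trans (le_abs_self C)⟩

lemma AxisPair.sub_orthogonal {Γ₀ : Subgroup (R21 ≃ₗ[ℝ] R21)} {α β : R21} (h : AxisPair Γ₀ α β) :
    B (α + β) (α - β) = 0 := by
  simp only [B_add_left, B_sub_right, h.left.1, h.right.1, B_comm β α]; ring

lemma AxisPair.B_sub {Γ₀ : Subgroup (R21 ≃ₗ[ℝ] R21)} {α β : R21} (h : AxisPair Γ₀ α β) :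
    B (α - β) (α - β) = 1 := by
  simp only [B_sub_left, B_sub_right, h.left.1, h.right.1, B_comm β α, h.pair]; norm_num

/-- The centre of a horodisk that an axis enters is not an end point of the axis. -/
lemma AxisPair.B_ne_zero {Γ₀ : Subgroup (R21 ≃ₗ[ℝ] R21)} {N : Set R21} (hN : IsCuspFamily Γ₀ N)
    {α β : R21} (h : AxisPair Γ₀ α β) {n : R21} (hn : n ∈ N) (hin : -B n (α + β) < 1) :
    B n α ≠ 0 := by
  intro h0
  obtain ⟨m, F⟩ := h.exists_nullFrame
  have hn0 := hN.null n hn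
  have h1 := F.B_self n
  rw [hn0.1, B_comm α n, h0] at h1
  have h2 : B m n = 0 := by
    have : B m n ^ 2 = 0 := by linarith
    exact pow_eq_zero_iff two_ne_zero |>.1 this
  have h3 := F.expand n
  rw [h2, B_comm α n, h0] at h3
  obtain ⟨A, hA, r, hr, hAα, -⟩ := h.hyperbolic
  have hr0 : r ≠ 0 := by linarith
  have hAn : A n = r • n := by
    have h4 : n = (-B ((2 : ℝ) • β) n) • α := by simpa using h3
    rw [h4, map_smul, hAα, smul_comm]
  have hmem := hN.invariant _ (Γ₀.inv_mem hA) n hn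
  rw [inv_apply_of_apply_eq_smul hr0 hAn] at hmem
  have hne : n ≠ r⁻¹ • n := by
    intro h5
    have h6 : n 2 = r⁻¹ * n 2 := by
      conv_lhs => rw [h5]
      simp
    have h7 : r⁻¹ = 1 := mul_right_cancel₀ hn0.2.ne' (by linarith)
    rw [inv_eq_one] at h7
    linarith
  refine Set.disjoint_left.1 (hN.disjoint n hn _ hmem hne)
    ((proj_mem_horodisk_iff_of_unit h.B_add h.add_pos).2 hin)
    ((proj_mem_horodisk_iff_of_unit h.B_add h.add_pos).2 ?_)
  rw [B_smul_left]
  have h8 := hn0.B_neg h.timelike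
  have h9 : r⁻¹ ≤ 1 := inv_le_one_of_one_le₀ hr.le
  nlinarith

/-- Along the axes of the hyperbolic elements, the component of an equivariant form with standard
cusps in the direction of the repelling end point is uniformly bounded, when the end points are
normalised at the point under consideration. -/
theorem exists_axis_form_bound {Γ₀ : Subgroup (R21 ≃ₗ[ℝ] R21)} (hΓ : IsFreeFuchsian Γ₀)
    {N : Set R21} (hN : IsCuspFamily Γ₀ N) {η : Plane → Plane →L[ℝ] R21}
    (hη : ContinuousOn η SPlus)
    (hequiv : ∀ A ∈ Γ₀, ∀ V, FutureTimelike V → ∀ W, coneForm η (A V) (A W) = A (coneForm η V W))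
    (hcusp : ∀ n ∈ N, IsStandardCuspFormOn η n) :
    ∃ C : ℝ, 0 ≤ C ∧ ∀ α β, AxisPair Γ₀ α β → |B (coneForm η (α + β) (α - β)) α| ≤ C := by
  obtain ⟨R, hR⟩ := exists_thick_axis_bound hΓ hN
  obtain ⟨C, hC0, hC⟩ := exists_compact_form_bound hη R
  -- All unit tangent vectors `W` are allowed, not only the axis direction: the horocycle direction
  -- is needed to bound `k` at the boundary of a horodisk.
  have hthick : ∀ α β, AxisPair Γ₀ α β → (∀ n ∈ N, 1 ≤ -B n (α + β)) → ∀ W,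
      B (α + β) W = 0 → B W W = 1 → |B (coneForm η (α + β) W) (α + β + W)| ≤ C := by
    intro α β hab hth W h1 h2
    obtain ⟨A, hA, hAR⟩ := hR α β hab hth
    have h3 := hC (A (α + β)) (A W) (by rw [hΓ.B_map hA, hab.B_add])
      (hΓ.futureTimelike hA hab.timelike).2 hAR (by rw [hΓ.B_map hA, h1]) (by rw [hΓ.B_map hA, h2])
    rwa [hequiv A hA _ hab.timelike, ← map_add A (α + β) W, hΓ.B_map hA] at h3
  refine ⟨C, hC0, fun α β hab => ?_⟩
  by_cases hth : ∀ n ∈ N, 1 ≤ -B n (α + β)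
  · have h1 := hthick α β hab hth (α - β) hab.sub_orthogonal hab.B_sub
    rw [show α + β + (α - β) = (2 : ℝ) • α by module, B_smul_right, abs_mul,
      abs_of_pos (zero_lt_two (α := ℝ))] at h1
    have := abs_nonneg (B (coneForm η (α + β) (α - β)) α)
    linarith
  push Not at hth
  obtain ⟨n, hn, hin⟩ := hth
  have hn0 := hN.null n hn
  obtain ⟨m, k, hm, hmn, hform⟩ := hcusp n hn
  have hp0 : 0 < -B n α := by
    refine lt_of_le_of_ne ?_ fun h => hab.B_ne_zero hN hn hin (by linarith)
    have := B_nonpos hn0.1.le hab.left.1.le hn0.2.le hab.left.2.le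
    linarith
  have hp0' : 0 ≤ -B n β := by
    have := B_nonpos hn0.1.le hab.right.1.le hn0.2.le hab.right.2.le
    linarith
  have hsum : -B n (α + β) = -B n α + -B n β := by rw [B_add_right]; ring
  obtain ⟨p, hp⟩ : ∃ p, p = -B n α := ⟨_, rfl⟩
  have hp1 : p < 1 := by linarith
  have hpp : 0 < p := by linarith
  -- Move along the axis towards `α` until it leaves the horodisk; at `c = p⁻¹` the first summand
  -- alone is already `1`.
  obtain ⟨c, ⟨hc1, -⟩, hc⟩ : ∃ c ∈ Set.Icc 1 p⁻¹, c * (-B n α) + c⁻¹ * (-B n β) = 1 := by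
    have hcont : ContinuousOn (fun c : ℝ => c * (-B n α) + c⁻¹ * (-B n β)) (Set.Icc 1 p⁻¹) := by
      refine ContinuousOn.add (by fun_prop) (ContinuousOn.mul (ContinuousOn.inv₀ (by fun_prop) ?_)
        (by fun_prop))
      intro c hc
      have := hc.1
      exact ne_of_gt (by linarith)
    refine intermediate_value_Icc (one_le_inv_iff₀.2 ⟨hpp, hp1.le⟩) hcont ⟨?_, ?_⟩
    · simp only [one_mul, inv_one]; linarith
    · rw [← hp, inv_mul_cancel₀ hpp.ne', inv_inv]
      have := mul_nonneg hpp.le hp0'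
      linarith
  have hc0 : 0 < c := by linarith
  have hab' := hab.scale hc0
  set V := c • α + c⁻¹ • β with hV
  have hVn : -B n V = 1 := by
    rw [hV, B_add_right, B_smul_right, B_smul_right]; linarith
  have hk : |k| ≤ C := by
    set W := m + B m V • n with hW
    have h1 : B V W = 0 := by
      rw [hW, B_add_right, B_smul_right, B_comm V m, B_comm V n, show B n V = -1 by linarith]; ring
    have h2 : B W W = 1 := by
      rw [hW]; simp only [B_add_left, B_add_right, B_smul_left, B_smul_right, hm, hmn, hn0.1,
        B_comm n m]; ring
    have h3 := hthick _ _ hab' (fun n' hn' => hN.boundary_thick hn hab'.B_add hab'.add_pos hVn hn')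
      W h1 h2
    rw [coneForm_eq_of_standard hη hn0 hform hab'.B_add hab'.add_pos hVn.le, hW,
      cuspDiff_tangent hn0.1 hm hmn hVn, one_smul, B_smul_left] at h3
    have h4 : B n (V + (m + B m V • n)) = -1 := by
      simp only [B_add_right, B_smul_right, hn0.1, B_comm n m, hmn]; linarith
    rw [h4] at h3
    simpa using h3
  rw [coneForm_eq_of_standard hη hn0 hform hab.B_add hab.add_pos hin.le, B_smul_left, B_smul_left,
    abs_mul, abs_mul]
  have h1 := abs_cuspDiff_le hn0 hm hmn hab.B_add hab.add_pos hab.sub_orthogonal hab.B_sub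
  have h2 : |B n α| ≤ -B n (α + β) := by
    rw [← abs_neg, abs_of_pos hp0, hsum]; linarith
  calc _ = |k| * (|cuspDiff n m (α + β) (α - β)| * |B n α|) := by ring
    _ ≤ |k| * (|cuspDiff n m (α + β) (α - β)| * -B n (α + β)) := by gcongr
    _ ≤ |k| * 1 := by gcongr
    _ ≤ C := by rw [mul_one]; exact hk

/-! ### Invariant space-like lines of hyperbolic affine isometries -/

/-- Both `H - F` and `H + F` are monotone. -/
lemma abs_sub_le_of_hasDerivAt {F F' H H' : ℝ → ℝ} (hF : ∀ t, HasDerivAt F (F' t) t)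
    (hH : ∀ t, HasDerivAt H (H' t) t) (h : ∀ t, |F' t| ≤ H' t) {a b : ℝ} (hab : a ≤ b) :
    |F b - F a| ≤ H b - H a := by
  have h1 : Monotone (H - F) := by
    refine monotone_of_deriv_nonneg (fun t => ((hH t).sub (hF t)).differentiableAt) fun t => ?_
    rw [((hH t).sub (hF t)).deriv]
    have := (abs_le.1 (h t)).2
    linarith
  have h2 : Monotone (H + F) := by
    refine monotone_of_deriv_nonneg (fun t => ((hH t).add (hF t)).differentiableAt) fun t => ?_
    rw [((hH t).add (hF t)).deriv]
    have := (abs_le.1 (h t)).1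
    linarith
  have h3 := h1 hab
  have h4 := h2 hab
  simp only [Pi.sub_apply, Pi.add_apply] at h3 h4
  rw [abs_le]; constructor <;> linarith

lemma coneForm_neg (η : Plane → Plane →L[ℝ] R21) (V W : R21) :
    coneForm η V (-W) = -coneForm η V W := by
  have : dproj V (-W) = -dproj V W := by
    ext i; fin_cases i <;> simp [dproj] <;> ring
  rw [coneForm, this, map_neg, coneForm]

lemma _root_.HasDerivAt.lorentz_const {f : ℝ → R21} {f' : R21} {t : ℝ} (h : HasDerivAt f f' t)
    (w : R21) : HasDerivAt (fun r => B (f r) w) (B f' w) t := by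
  have hc : ∀ i, HasDerivAt (fun r => f r i) (f' i) t := fun i =>
    (EuclideanSpace.proj i : R21 →L[ℝ] ℝ).hasFDerivAt.comp_hasDerivAt t h
  exact (((hc 0).mul_const (w 0)).add ((hc 1).mul_const (w 1))).sub ((hc 2).mul_const (w 2))

/-- A hyperbolic affine isometry acts on a space-like line at a distance from the value of an
equivariant section at a point of the axis that is controlled by the differential of the section
along the axis. -/
lemma AxisPair.exists_spacelike_line {Γ₀ : Subgroup (R21 ≃ₗ[ℝ] R21)} {α β : R21}
    (h : AxisPair Γ₀ α β) {η : Plane → Plane →L[ℝ] R21} {s : Plane → R21}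
    (hs : ∀ p ∈ SPlus, HasFDerivAt s (η p) p) {C : ℝ}
    (hC : ∀ α β, AxisPair Γ₀ α β → |B (coneForm η (α + β) (α - β)) α| ≤ C)
    {g : R21 ≃ᵃ[ℝ] R21} (hB : ∀ x y, B (g.linear x) (g.linear y) = B x y)
    (hg : ∀ p ∈ SPlus, s (act g.linear p) = g (s p)) {r : ℝ} (hr : 1 < r)
    (hα : g.linear α = r • α) (hβ : g.linear β = r⁻¹ • β) :
    ∃ l : Set R21, IsSpacelikeLine l ∧ g '' l = l ∧
      ∃ q ∈ l, ‖q - s (proj (α + β))‖ ≤ 2 * C * (‖α‖ + ‖β‖) := by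
  set A := g.linear with hA
  have hr0 : 0 < r := by linarith
  set V : ℝ → R21 := fun t => Real.exp t • α + Real.exp (-t) • β with hV
  set V' : ℝ → R21 := fun t => Real.exp t • α - Real.exp (-t) • β with hV'
  have hVd : ∀ t, HasDerivAt V (V' t) t := by
    intro t
    have h1 := (Real.hasDerivAt_exp t).smul_const α
    have h2 := ((hasDerivAt_neg t).exp).smul_const β
    have e : V' t = Real.exp t • α + (Real.exp (-t) * -1) • β := by simp only [hV']; module
    rw [e]
    exact h1.add h2
  have hscale : ∀ t, AxisPair Γ₀ (Real.exp t • α) (Real.exp (-t) • β) := by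
    intro t
    rw [Real.exp_neg]
    exact h.scale (Real.exp_pos t)
  set f : ℝ → R21 := fun t => s (proj (V t)) with hf
  have hfd : ∀ t, HasDerivAt f (coneForm η (V t) (V' t)) t := fun t =>
    hasDerivAt_section hs (hVd t) (hscale t).timelike
  -- The bound holds for the pair rescaled at time `t`; in terms of the fixed `α` the rescaling
  -- becomes the factor `e^{-t}`. For `β` the reversed pair is used.
  have hboundα : ∀ t, |B (coneForm η (V t) (V' t)) α| ≤ C * Real.exp (-t) := by
    intro t
    have h1 := hC _ _ (hscale t)
    rw [B_smul_right, abs_mul, abs_of_pos (Real.exp_pos t)] at h1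
    rw [Real.exp_neg, ← div_eq_mul_inv, le_div_iff₀ (Real.exp_pos t)]
    linarith
  have hboundβ : ∀ t, |B (coneForm η (V t) (V' t)) β| ≤ C * Real.exp t := by
    intro t
    have h1 := hC _ _ (hscale t).symm
    rw [add_comm, ← neg_sub, coneForm_neg, B_neg_left, abs_neg, B_smul_right, abs_mul,
      abs_of_pos (Real.exp_pos _), Real.exp_neg, inv_mul_le_iff₀ (Real.exp_pos t)] at h1
    simp only [hV, hV']
    rw [Real.exp_neg]
    linarith
  set T := Real.log r with hT
  have hT0 : 0 ≤ T := Real.log_nonneg hr.le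
  have hexpT : Real.exp T = r := Real.exp_log hr0
  have hexpT' : Real.exp (-T) = r⁻¹ := by rw [Real.exp_neg, hexpT]
  have hf0 : f 0 = s (proj (α + β)) := by simp [hf, hV]
  have hfT : f T = g (s (proj (α + β))) := by
    rw [← hg _ (proj_mem_SPlus h.timelike), act_proj _ h.timelike.2.ne']
    simp only [hf, hV, hexpT, hexpT', map_add, hα, hβ]
  set x₀ := s (proj (α + β)) with hx₀
  set D := g x₀ - x₀ with hD
  have hDα : |B α D| ≤ C * (1 - r⁻¹) := by
    have h1 := abs_sub_le_of_hasDerivAt (fun t => (hfd t).lorentz_const α)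
      (H := fun t => -(C * Real.exp (-t))) (H' := fun t => C * Real.exp (-t))
      (fun t => by
        rw [show C * Real.exp (-t) = -(C * (Real.exp (-t) * -1)) by ring]
        exact (((hasDerivAt_neg t).exp).const_mul C).neg) hboundα hT0
    rw [← B_sub_left, hfT, hf0, hexpT', B_comm] at h1
    simp only [neg_zero, Real.exp_zero] at h1
    linarith
  have hDβ : |B β D| ≤ C * (r - 1) := by
    have h1 := abs_sub_le_of_hasDerivAt (fun t => (hfd t).lorentz_const β)
      (H := fun t => C * Real.exp t) (H' := fun t => C * Real.exp t)
      (fun t => (Real.hasDerivAt_exp t).const_mul C) hboundβ hT0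
    rw [← B_sub_left, hfT, hf0, hexpT, B_comm] at h1
    simp only [Real.exp_zero] at h1
    linarith
  obtain ⟨m, F⟩ := h.exists_nullFrame
  obtain ⟨ε, hε, hAm⟩ := F.apply_normal hB hr0.ne' hα (by rw [map_smul, hβ, smul_comm])
  have hr1 : 0 < r - 1 := by linarith
  have hr2 : 0 < 1 - r⁻¹ := by
    have := inv_lt_one_of_one_lt₀ hr
    linarith
  -- These solve `(A - 1) (c₁ • α + c₂ • β) = -(α- and β-components of D)`; the factor `2` appears
  -- because `α` is paired to `-1` with `2 • β`. The bounds on `D` cancel the denominators exactly.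
  set c₁ := 2 * B β D / (r - 1) with hc₁
  set c₂ := -(2 * B α D / (1 - r⁻¹)) with hc₂
  set q := (c₁ • α + c₂ • β) + x₀ with hq
  have hgq : g q = q + B m D • m := by
    have h1 : g q = A (c₁ • α + c₂ • β) + g x₀ := g.map_vadd x₀ (c₁ • α + c₂ • β)
    have h2 : g x₀ = x₀ + D := by rw [hD]; abel
    have h3 := F.expand D
    have h4 : c₁ * (r - 1) = 2 * B β D := by rw [hc₁]; field_simp
    have h5 : c₂ * (1 - r⁻¹) = -(2 * B α D) := by
      rw [hc₂, neg_mul, div_mul_cancel₀ _ hr2.ne']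
    rw [h1, h2, map_add, map_smul, map_smul, hα, hβ, hq]
    rw [B_smul_left] at h3
    conv_lhs => rw [h3]
    match_scalars <;> linarith
  have hgl : ∀ t : ℝ, g (q + t • m) = q + (B m D + t * ε) • m := by
    intro t
    have h1 : g (t • m + q) = A (t • m) + g q := g.map_vadd q (t • m)
    rw [add_comm, h1, hgq, map_smul, hAm]
    module
  refine ⟨{x | ∃ t : ℝ, x = q + t • m}, ⟨q, m, by rw [F.mm]; norm_num, rfl⟩, ?_, q,
    ⟨0, by simp⟩, ?_⟩
  · ext x
    constructor
    · rintro ⟨_, ⟨t, rfl⟩, rfl⟩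
      exact ⟨_, hgl t⟩
    · rintro ⟨t, rfl⟩
      refine ⟨_, ⟨(t - B m D) * ε, rfl⟩, ?_⟩
      rw [hgl, mul_assoc, ← sq, hε]
      module
  · have h1 : |c₁| ≤ 2 * C := by
      rw [hc₁, abs_div, abs_of_pos hr1, div_le_iff₀ hr1, abs_mul, abs_of_pos (zero_lt_two (α := ℝ))]
      linarith
    have h2 : |c₂| ≤ 2 * C := by
      rw [hc₂, abs_neg, abs_div, abs_of_pos hr2, div_le_iff₀ hr2, abs_mul,
        abs_of_pos (zero_lt_two (α := ℝ))]
      linarith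
    rw [hq, add_sub_cancel_right]
    refine (norm_add_le _ _).trans ?_
    rw [norm_smul, norm_smul, Real.norm_eq_abs, Real.norm_eq_abs, mul_add]
    gcongr

/-- The axis of a hyperbolic element, in terms of null eigenvectors. -/
lemma exists_axisPair {Γ₀ : Subgroup (R21 ≃ₗ[ℝ] R21)} (hΓ : IsFreeFuchsian Γ₀)
    {A : R21 ≃ₗ[ℝ] R21} (hA : A ∈ Γ₀) (hhyp : IsHyperbolic A) {l : Set Plane} (hl : IsGeodesic l)
    (hAl : act A '' l = l) {p : Plane} (hp : p ∈ l) (hpS : p ∈ SPlus) :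
    ∃ α β : R21, AxisPair Γ₀ α β ∧ α + β = (√(1 - ‖p‖ ^ 2))⁻¹ • lift p ∧
      ∃ r : ℝ, 1 < r ∧ A α = r • α ∧ A β = r⁻¹ • β := by
  obtain ⟨a, ha, b, hb, -, rfl⟩ := hl
  have hnull : ∀ a ∈ Metric.sphere (0 : Plane) 1, FutureNull (lift a) := by
    intro a ha
    rw [mem_sphere_zero_iff_norm] at ha
    exact ⟨by rw [B_lift, ha]; norm_num, by simp [lift]⟩
  obtain ⟨x, y, hx, hy, hxy, hpxy⟩ := hp
  have hlift : ∀ x y : ℝ, x + y = 1 → lift (x • a + y • b) = x • lift a + y • lift b := by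
    intro x y h
    apply ext3 <;> simp [lift, h]
  rw [SPlus, mem_ball_zero_iff] at hpS
  have hp1 : 0 < 1 - ‖p‖ ^ 2 := by nlinarith [norm_nonneg p]
  set c := (√(1 - ‖p‖ ^ 2))⁻¹ with hc
  have hc0 : 0 < c := inv_pos.2 (Real.sqrt_pos.2 hp1)
  have hc2 : c ^ 2 * (1 - ‖p‖ ^ 2) = 1 := by
    rw [hc, inv_pow, Real.sq_sqrt hp1.le, inv_mul_cancel₀ hp1.ne']
  set α := (c * x) • lift a with hα
  set β := (c * y) • lift b with hβ
  have hαn : FutureNull α := (hnull a ha).smul (mul_pos hc0 hx)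
  have hβn : FutureNull β := (hnull b hb).smul (mul_pos hc0 hy)
  have hsum : α + β = c • lift p := by
    rw [← hpxy, hlift x y hxy, hα, hβ]; module
  have hpair : B α β = -1 / 2 := by
    have h1 : B (α + β) (α + β) = -1 := by
      rw [hsum, B_smul_left, B_smul_right, B_lift]; linarith
    simp only [B_add_left, B_add_right, hαn.1, hβn.1, B_comm β α] at h1
    linarith
  -- Invariance of the chord sends positive combinations of `α` and `β` into their plane; two such
  -- combinations then determine the action on that plane.
  have hspan : ∀ u v : ℝ, 0 < u → 0 < v → ∃ u' v' : ℝ, A (u • α + v • β) = u' • α + v' • β := by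
    intro u v hu hv
    set w := u • α + v • β with hw
    obtain ⟨u₁, v₁, hu₁, hv₁, hw₁⟩ : ∃ u₁ v₁ : ℝ, 0 < u₁ ∧ 0 < v₁ ∧
        w = u₁ • lift a + v₁ • lift b :=
      ⟨u * (c * x), v * (c * y), by positivity, by positivity, by rw [hw, hα, hβ]; module⟩
    have hs : 0 < u₁ + v₁ := by positivity
    have hmem : proj w ∈ openSegment ℝ a b := by
      refine ⟨u₁ / (u₁ + v₁), v₁ / (u₁ + v₁), by positivity, by positivity, by field_simp, ?_⟩
      rw [← proj_lift (_ + _), hlift _ _ (by field_simp), hw₁, ← proj_smul hs.ne']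
      congr 1
      rw [smul_add, smul_smul, smul_smul, mul_div_cancel₀ _ hs.ne', mul_div_cancel₀ _ hs.ne']
    have hwt : FutureTimelike w := by
      refine ⟨?_, ?_⟩
      · rw [hw]
        simp only [B_add_left, B_add_right, B_smul_left, B_smul_right, hαn.1, hβn.1, B_comm β α,
          hpair]
        have := mul_pos hu hv
        linarith
      · have := hαn.2
        have := hβn.2
        simp only [hw, PiLp.add_apply, PiLp.smul_apply, smul_eq_mul]
        positivity
    have hAw : act A (proj w) ∈ openSegment ℝ a b := by
      have := Set.mem_image_of_mem (act A) hmem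
      rwa [hAl] at this
    have hAwt := hΓ.futureTimelike hA hwt
    rw [act_proj A hwt.2.ne'] at hAw
    obtain ⟨x', y', -, -, hxy', he⟩ := hAw
    have h1 := hlift x' y' hxy'
    rw [he, lift_proj hAwt.2.ne'] at h1
    refine ⟨(A w) 2 * x' / (c * x), (A w) 2 * y' / (c * y), ?_⟩
    rw [inv_smul_eq_iff₀ hAwt.2.ne'] at h1
    conv_lhs => rw [h1]
    rw [hα, hβ, smul_smul, smul_smul, div_mul_cancel₀ _ (by positivity),
      div_mul_cancel₀ _ (by positivity)]
    module
  obtain ⟨u₁, v₁, h₁⟩ := hspan 1 1 one_pos one_pos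
  obtain ⟨u₂, v₂, h₂⟩ := hspan 1 2 one_pos two_pos
  rw [map_add, map_smul A (1 : ℝ) α, map_smul A (1 : ℝ) β] at h₁
  rw [map_add, map_smul A (1 : ℝ) α, map_smul A (2 : ℝ) β] at h₂
  have hAβ : A β = (u₂ - u₁) • α + (v₂ - v₁) • β := by
    have : A β = ((1 : ℝ) • A α + (2 : ℝ) • A β) - ((1 : ℝ) • A α + (1 : ℝ) • A β) := by module
    rw [this, h₁, h₂]; module
  have hAα : A α = (2 * u₁ - u₂) • α + (2 * v₁ - v₂) • β := by
    have : A α = (2 : ℝ) • ((1 : ℝ) • A α + (1 : ℝ) • A β) - ((1 : ℝ) • A α + (2 : ℝ) • A β) := by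
      module
    rw [this, h₁, h₂]; module
  obtain ⟨p₁, hp₁⟩ : ∃ p₁, p₁ = u₂ - u₁ := ⟨_, rfl⟩
  obtain ⟨q₁, hq₁⟩ : ∃ q₁, q₁ = v₂ - v₁ := ⟨_, rfl⟩
  obtain ⟨p₂, hp₂⟩ : ∃ p₂, p₂ = 2 * u₁ - u₂ := ⟨_, rfl⟩
  obtain ⟨q₂, hq₂⟩ : ∃ q₂, q₂ = 2 * v₁ - v₂ := ⟨_, rfl⟩
  rw [← hp₁, ← hq₁] at hAβ
  rw [← hp₂, ← hq₂] at hAα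
  have e1 : p₂ * q₂ = 0 := by
    have h3 := hΓ.B_map hA α α
    rw [hAα] at h3
    simp only [B_add_left, B_add_right, B_smul_left, B_smul_right, hαn.1, hβn.1, B_comm β α,
      hpair] at h3
    linarith
  have e2 : p₁ * q₁ = 0 := by
    have h3 := hΓ.B_map hA β β
    rw [hAβ] at h3
    simp only [B_add_left, B_add_right, B_smul_left, B_smul_right, hαn.1, hβn.1, B_comm β α,
      hpair] at h3
    linarith
  have e3 : p₂ * q₁ + q₂ * p₁ = 1 := by
    have h3 := hΓ.B_map hA α β
    rw [hAα, hAβ] at h3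
    simp only [B_add_left, B_add_right, B_smul_left, B_smul_right, hαn.1, hβn.1, B_comm β α,
      hpair] at h3
    linarith
  obtain ⟨ev, hev1, hev⟩ := hhyp
  obtain ⟨v, hv⟩ := hev.exists_hasEigenvector
  have hAv : A v = ev • v := hv.apply_eq_smul
  have hev2 : 1 < ev ^ 2 := one_lt_pow₀ hev1 two_ne_zero
  have hvv : B v v = 0 := by
    have h3 := hΓ.B_map hA v v
    rw [hAv, B_smul_left, B_smul_right] at h3
    have h4 : (ev ^ 2 - 1) * B v v = 0 := by linarith
    exact (mul_eq_zero.1 h4).resolve_left (by linarith)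
  -- A vector orthogonal to `α` and `β` is a multiple of the unit normal; being null it vanishes,
  -- which an eigenvector cannot.
  have hcontra : B v α = 0 → B v β = 0 → False := by
    intro h3 h4
    obtain ⟨m, F⟩ := exists_nullFrame_of_pair (n := α) (n' := (2 : ℝ) • β) hαn.1
      (by rw [B_smul_left, B_smul_right, hβn.1]; ring) (by rw [B_smul_right, hpair]; ring)
    have h5 := F.B_self v
    have h6 := F.expand v
    rw [B_comm α v, h3, B_smul_left, B_comm β v, h4] at h5 h6
    have h7 : B m v = 0 := by
      have : B m v ^ 2 = 0 := by linarith
      exact pow_eq_zero_iff two_ne_zero |>.1 this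
    rw [h7] at h6
    exact hv.2 (by simpa using h6)
  -- An isometry of the Lorentzian plane permutes its two null lines. If it exchanges them, `A²`
  -- fixes `α` and `β`, which is incompatible with an eigenvalue `> 1`.
  rcases mul_eq_zero.1 e1 with h0 | h0
  · exfalso
    rw [h0] at e3 hAα
    have h1 : q₂ * p₁ = 1 := by linarith
    have h2 : q₁ = 0 := (mul_eq_zero.1 e2).resolve_left (right_ne_zero_of_mul_eq_one h1)
    rw [h2] at hAβ
    have h3 := hΓ.B_map hA v α
    have h4 := hΓ.B_map hA v β
    rw [hAv, hAα] at h3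
    rw [hAv, hAβ] at h4
    simp only [B_add_right, B_smul_left, B_smul_right, zero_mul, zero_add, add_zero] at h3 h4
    have h5 : (ev ^ 2 - 1) * B v α = 0 := by
      have : B v α = ev ^ 2 * (q₂ * p₁) * B v α := by
        conv_lhs => rw [← h3, ← h4]
        ring
      rw [h1] at this
      linarith
    have h6 := (mul_eq_zero.1 h5).resolve_left (by linarith)
    rw [h6] at h4
    exact hcontra h6 (by linarith)
  · rw [h0] at e3 hAα
    have h1 : p₂ * q₁ = 1 := by linarith
    have h2 : p₁ = 0 := (mul_eq_zero.1 e2).resolve_right (right_ne_zero_of_mul_eq_one h1)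
    have h3 : q₁ = p₂⁻¹ := eq_inv_of_mul_eq_one_right h1
    rw [h2, h3] at hAβ
    have hAα' : A α = p₂ • α := by simpa using hAα
    have hAβ' : A β = p₂⁻¹ • β := by simpa using hAβ
    have hp₂0 : 0 < p₂ := by
      have h4 := (hΓ.futureNull hA hαn).2
      rw [hAα', PiLp.smul_apply, smul_eq_mul] at h4
      exact pos_of_mul_pos_left h4 hαn.2.le
    rcases lt_trichotomy p₂ 1 with h4 | h4 | h4
    · have h5 : 1 < p₂⁻¹ := (one_lt_inv₀ hp₂0).2 h4
      refine ⟨β, α, ⟨hβn, hαn, by rw [B_comm, hpair], A, hA, p₂⁻¹, h5, hAβ', by rwa [inv_inv]⟩,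
        by rw [add_comm, hsum], p₂⁻¹, h5, hAβ', by rwa [inv_inv]⟩
    · exfalso
      have h5 := hΓ.B_map hA v α
      have h6 := hΓ.B_map hA v β
      rw [hAv, hAα', h4, one_smul, B_smul_left] at h5
      rw [hAv, hAβ', h4, inv_one, one_smul, B_smul_left] at h6
      refine hcontra ?_ ?_
      · exact (mul_eq_zero.1 (by linarith : (ev - 1) * B v α = 0)).resolve_left (by linarith)
      · exact (mul_eq_zero.1 (by linarith : (ev - 1) * B v β = 0)).resolve_left (by linarith)
    · exact ⟨α, β, ⟨hαn, hβn, hpair, A, hA, p₂, h4, hAα', hAβ'⟩, hsum, p₂, h4, hAα', hAβ'⟩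

/-! ### Determination of the form by the thick part -/

lemma proj_not_mem_horodiskUnion {N : Set R21} {V : R21} (hV : B V V = -1) (hV2 : 0 < V 2)
    (h : ∀ n ∈ N, 1 ≤ -B n V) : proj V ∈ SPlus \ horodiskUnion N := by
  refine ⟨proj_mem_SPlus ⟨by rw [hV]; norm_num, hV2⟩, ?_⟩
  rw [horodiskUnion, Set.mem_iUnion₂]
  rintro ⟨n, hn, hmem⟩
  rw [proj_mem_horodisk_iff_of_unit hV hV2] at hmem
  exact absurd hmem (not_lt.2 (h n hn))

/-- The `n`-component of `m₁` only adds a constant to the horizontal coordinate, so the differential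
sees just the `m`-component. -/
lemma NullFrame.cuspDiff_eq {n m n' : R21} (F : NullFrame n m n') {m₁ : R21} (h2 : B m₁ n = 0) : ∃ ε : ℝ, ∀ V W, cuspDiff n m₁ V W = ε * cuspDiff n m V W := by
  refine ⟨B m m₁, fun V W => ?_⟩
  have h3 := F.expand m₁
  rw [B_comm n m₁, h2] at h3
  have h4 : ∀ x, B m₁ x = -B n' m₁ * B n x + B m m₁ * B m x := by
    intro x
    conv_lhs => rw [h3]
    simp only [B_add_left, B_smul_left]; ring
  rw [cuspDiff, h4 V, h4 W, cuspDiff]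
  ring

/-- A form with standard cusps is determined by its restriction to the complement of the
horodisks. -/
lemma eqOn_of_eqOn_thick {Γ₀ : Subgroup (R21 ≃ₗ[ℝ] R21)} {N : Set R21} (hN : IsCuspFamily Γ₀ N)
    {η η' : Plane → Plane →L[ℝ] R21} (hη : ContinuousOn η SPlus) (hη' : ContinuousOn η' SPlus)
    (hcusp : ∀ n ∈ N, IsStandardCuspFormOn η n) (hcusp' : ∀ n ∈ N, IsStandardCuspFormOn η' n)
    (h : Set.EqOn η η' (SPlus \ horodiskUnion N)) : Set.EqOn η η' SPlus := by
  intro p hp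
  by_cases hpN : p ∈ horodiskUnion N
  swap
  · exact h ⟨hp, hpN⟩
  rw [horodiskUnion, Set.mem_iUnion₂] at hpN
  obtain ⟨n, hn, hpn⟩ := hpN
  have hn0 := hN.null n hn
  obtain ⟨m₁, k₁, -, hmn₁, hform₁⟩ := hcusp n hn
  obtain ⟨m₂, k₂, -, hmn₂, hform₂⟩ := hcusp' n hn
  obtain ⟨m, n', F, hn'⟩ := hn0.exists_nullFrame
  obtain ⟨ε₁, hε₁⟩ := F.cuspDiff_eq hmn₁
  obtain ⟨ε₂, hε₂⟩ := F.cuspDiff_eq hmn₂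
  -- A point on the boundary horocycle, hence in the thick part: the two forms agree there, and the
  -- horocycle direction reads off their coefficients.
  set V := n' + (1 / 2 : ℝ) • n with hV
  have hVV : B V V = -1 := by
    rw [hV]; simp only [B_add_left, B_add_right, B_smul_left, B_smul_right, F.nn, F.nn',
      B_comm n' n, F.pair]; norm_num
  have hV2 : 0 < V 2 := by
    have := hn0.2
    have := hn'.2
    simp only [hV, PiLp.add_apply, PiLp.smul_apply, smul_eq_mul]; positivity
  have hVn : -B n V = 1 := by
    rw [hV, B_add_right, B_smul_right, F.nn, F.pair]; norm_num
  have hk : k₁ * ε₁ = k₂ * ε₂ := by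
    set W := m + B m V • n with hW
    have h1 := h (proj_not_mem_horodiskUnion hVV hV2
      fun _ hn'' => hN.boundary_thick hn hVV hV2 hVn hn'')
    have h2 : coneForm η V W = coneForm η' V W := by rw [coneForm, h1, coneForm]
    rw [coneForm_eq_of_standard hη hn0 hform₁ hVV hV2 hVn.le,
      coneForm_eq_of_standard hη' hn0 hform₂ hVV hV2 hVn.le, hε₁, hε₂, hW,
      cuspDiff_tangent hn0.1 F.mm (by rw [B_comm, F.nm]) hVn] at h2
    have h3 := congrArg (fun x : R21 => x 2) h2
    simp only [PiLp.smul_apply, smul_eq_mul, mul_one] at h3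
    have h4 : (k₁ * ε₁) * n 2 = (k₂ * ε₂) * n 2 := by linarith
    exact mul_right_cancel₀ hn0.2.ne' h4
  ext1 u
  have hlt := futureTimelike_lift hp
  have hu : u = dproj (lift p) !₂[u 0, u 1, 0] := by
    ext i; fin_cases i <;> simp [dproj, lift]
  rw [hform₁ p hpn, hform₂ p hpn, hu, ← proj_lift p]
  conv_lhs => rw [lift_proj hlt.2.ne']
  conv_rhs => rw [lift_proj hlt.2.ne']
  have hl2 : lift p 2 = 1 := by simp [lift]
  rw [hl2, inv_one, one_smul, fderiv_cuspCoord hn0 hlt, fderiv_cuspCoord hn0 hlt, hε₁, hε₂,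
    smul_smul, smul_smul]
  congr 1
  linear_combination (cuspDiff n m (lift p) !₂[u 0, u 1, 0]) * hk

/-! ### The common ball and its independence of the group -/

lemma isOpen_SPlus : IsOpen SPlus := Metric.isOpen_ball

/-- For a fixed group and form, the invariant lines of the elements of `hyperbolicMeeting Γ Khat`
meet a common ball. -/
theorem exists_ball_meeting_lines {Γ₀ : Subgroup (R21 ≃ₗ[ℝ] R21)}
    {Γ : Subgroup (R21 ≃ᵃ[ℝ] R21)} (hΓ : IsFreeFuchsian Γ₀)
    (hlin : Γ.map (AffineEquiv.linearHom : (R21 ≃ᵃ[ℝ] R21) →* (R21 ≃ₗ[ℝ] R21)) = Γ₀)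
    {N : Set R21} (hN : IsCuspFamily Γ₀ N) {Khat : Set Plane} (hKc : IsCompact Khat)
    (hK : Khat ⊆ SPlus) {η : Plane → Plane →L[ℝ] R21} (hη : ContinuousOn η SPlus)
    (hcusp : ∀ n ∈ N, IsStandardCuspFormOn η n) {s : Plane → R21}
    (hs : ∀ p ∈ SPlus, HasFDerivAt s (η p) p)
    (hg : ∀ g ∈ Γ, ∀ p ∈ SPlus, s (act g.linear p) = g (s p)) :
    ∃ ρ : ℝ, 0 ≤ ρ ∧ ∀ g ∈ hyperbolicMeeting Γ Khat, ∃ l : Set R21, IsSpacelikeLine l ∧ g '' l = l ∧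
      (l ∩ Metric.closedBall 0 ρ).Nonempty := by
  have hmem : ∀ g ∈ Γ, g.linear ∈ Γ₀ := fun g hgΓ => hlin ▸ Subgroup.mem_map_of_mem _ hgΓ
  obtain ⟨C, hC0, hC⟩ := exists_axis_form_bound hΓ hN hη (by
    intro A hA V hV W
    rw [← hlin] at hA
    obtain ⟨g, hgΓ, rfl⟩ := hA
    exact coneForm_equivariant hs (hg g hgΓ)
      (fun x hx => hΓ.futureTimelike (hmem g hgΓ) hx) hV W) hcusp
  obtain ⟨D, hD⟩ : ∃ D : ℝ, ∀ p ∈ Khat, (√(1 - ‖p‖ ^ 2))⁻¹ ≤ D := by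
    have hcont : ContinuousOn (fun p : Plane => (√(1 - ‖p‖ ^ 2))⁻¹) Khat := by
      refine ContinuousOn.inv₀ (by fun_prop) fun p hp => ?_
      have := mem_ball_zero_iff.1 (hK hp)
      exact (Real.sqrt_pos.2 (by nlinarith [norm_nonneg p])).ne'
    obtain ⟨D, hD⟩ := hKc.bddAbove_image hcont
    exact ⟨D, fun p hp => hD ⟨p, hp, rfl⟩⟩
  obtain ⟨S, hS⟩ : ∃ S : ℝ, ∀ p ∈ Khat, ‖s p‖ ≤ S := by
    have hcont : ContinuousOn (fun p => ‖s p‖) Khat := fun p hp =>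
      (hs p (hK hp)).continuousAt.norm.continuousWithinAt
    obtain ⟨S, hS⟩ := hKc.bddAbove_image hcont
    exact ⟨S, fun p hp => hS ⟨p, hp, rfl⟩⟩
  -- `S` bounds `s` on `Khat`, and `D` bounds the height of `α + β`, hence of `α` and `β`; the norm
  -- of a null vector is at most twice its height.
  refine ⟨|S| + 2 * C * (2 * |D| + 2 * |D|), by positivity, ?_⟩
  rintro g ⟨hgΓ, hhyp, l, hl, hgl, p, hpl, hpK⟩
  have hgl0 := hmem g hgΓ
  obtain ⟨α, β, hab, hsum, r, hr, hα, hβ⟩ := exists_axisPair hΓ hgl0 hhyp hl hgl hpl (hK hpK)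
  obtain ⟨l', hl', hgl', q, hq, hqn⟩ := hab.exists_spacelike_line hs hC
    (fun x y => hΓ.B_map hgl0 x y) (hg g hgΓ) hr hα hβ
  refine ⟨l', hl', hgl', q, hq, ?_⟩
  have hpos : 0 < 1 - ‖p‖ ^ 2 := by
    have := mem_ball_zero_iff.1 (hK hpK)
    nlinarith [norm_nonneg p]
  have hproj : proj (α + β) = p := by
    rw [hsum, proj_smul (inv_ne_zero (Real.sqrt_pos.2 hpos).ne'), proj_lift]
  have htime : (α + β) 2 ≤ |D| := by
    rw [hsum]
    have h1 := (hD p hpK).trans (le_abs_self D)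
    simpa [lift] using h1
  have hnorm : ∀ x : R21, FutureNull x → x 2 ≤ |D| → ‖x‖ ≤ 2 * |D| := by
    intro x hx hxD
    refine le_of_sq_le_sq ?_ (by positivity)
    rw [norm_sq_eq_B, hx.1, mul_pow]
    have := pow_le_pow_left₀ hx.2.le hxD 2
    nlinarith [sq_nonneg |D|]
  simp only [PiLp.add_apply] at htime
  have h1 := hnorm α hab.left (by have := hab.right.2; linarith)
  have h2 := hnorm β hab.right (by have := hab.left.2; linarith)
  rw [hproj] at hqn
  rw [mem_closedBall_zero_iff]
  have h3 : ‖q‖ ≤ ‖q - s p‖ + ‖s p‖ := by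
    simpa using norm_add_le (q - s p) (s p)
  have h4 : 2 * C * (‖α‖ + ‖β‖) ≤ 2 * C * (2 * |D| + 2 * |D|) := by gcongr
  have h5 := (hS p hpK).trans (le_abs_self S)
  linarith

/-- As the linear parts agree, conjugacy by the translation need only be checked at one point. -/
lemma image_add_const_of_semiconj {g g' : R21 ≃ᵃ[ℝ] R21} (hlin : g'.linear = g.linear) {x d : R21}
    (hx : g' (x + d) = g x + d) {l : Set R21} (hl : g '' l = l) :
    g' '' ((· + d) '' l) = (· + d) '' l := by
  have h : ∀ y, g' (y + d) = g y + d := by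
    intro y
    have h1 : g' ((y - x) + (x + d)) = g'.linear (y - x) + g' (x + d) := g'.map_vadd (x + d) (y - x)
    have h2 : g ((y - x) + x) = g.linear (y - x) + g x := g.map_vadd x (y - x)
    rw [sub_add_cancel] at h2
    rw [show y + d = (y - x) + (x + d) by abel, h1, hx, hlin, h2]
    abel
  rw [Set.image_image]
  simp_rw [h]
  rw [← Set.image_image (· + d) g, hl]

lemma IsSpacelikeLine.image_add_const {l : Set R21} (hl : IsSpacelikeLine l) (d : R21) :
    IsSpacelikeLine ((· + d) '' l) := by
  obtain ⟨q, v, hv, rfl⟩ := hl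
  refine ⟨q + d, v, hv, ?_⟩
  ext x
  constructor
  · rintro ⟨_, ⟨t, rfl⟩, rfl⟩
    exact ⟨t, by simp only; abel⟩
  · rintro ⟨t, rfl⟩
    exact ⟨q + t • v, ⟨t, rfl⟩, by simp only; abel⟩

end Margulis

theorem theorem4p8
    (Γ₀ : Subgroup (Margulis.R21 ≃ₗ[ℝ] Margulis.R21))
    (N : Set Margulis.R21) (hN : Margulis.IsCuspFamily Γ₀ N)
    (Khat : Set Margulis.Plane) (hKc : IsCompact Khat)
    (hK : Khat ⊆ Margulis.SPlus \ Margulis.horodiskUnion N)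
    (η₀ : Margulis.Plane → Margulis.Plane →L[ℝ] Margulis.R21) :
    ∃ C : ℝ,
      ∀ (Γ : Subgroup (Margulis.R21 ≃ᵃ[ℝ] Margulis.R21))
        (η : Margulis.Plane → Margulis.Plane →L[ℝ] Margulis.R21),
        Margulis.IsProperAffineHyperbolic Γ₀ Γ →
        Margulis.IsBundleForm Γ₀ η →
        Margulis.Represents η Γ →
        (∀ n ∈ N, Margulis.IsStandardCuspFormOn η n) →
        Set.EqOn η η₀ (Margulis.SPlus \ Margulis.horodiskUnion N) →
        ∃ K : Set Margulis.R21, Bornology.IsBounded K ∧ Metric.diam K < C ∧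
          ∀ g ∈ Margulis.hyperbolicMeeting Γ Khat,
            ∃ l : Set Margulis.R21, Margulis.IsSpacelikeLine l ∧ g '' l = l ∧
              (l ∩ K).Nonempty := by
  have hKS : Khat ⊆ Margulis.SPlus := fun p hp => (hK hp).1
  -- The constant precedes `Γ` and `η`, so it is read off from one admissible pair; if there is
  -- none, any constant works.
  by_cases hex : ∃ (Γ : Subgroup (Margulis.R21 ≃ᵃ[ℝ] Margulis.R21))
      (η : Margulis.Plane → Margulis.Plane →L[ℝ] Margulis.R21),
      Margulis.IsProperAffineHyperbolic Γ₀ Γ ∧ Margulis.IsBundleForm Γ₀ η ∧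
      Margulis.Represents η Γ ∧ (∀ n ∈ N, Margulis.IsStandardCuspFormOn η n) ∧
      Set.EqOn η η₀ (Margulis.SPlus \ Margulis.horodiskUnion N)
  swap
  · exact ⟨0, fun Γ η h1 h2 h3 h4 h5 => absurd ⟨Γ, η, h1, h2, h3, h4, h5⟩ hex⟩
  obtain ⟨Γ₁, η₁, hΓ₁, hη₁, ⟨s₁, hs₁, hg₁⟩, hcusp₁, heq₁⟩ := hex
  obtain ⟨ρ, hρ, hlines⟩ := Margulis.exists_ball_meeting_lines hΓ₁.fuchsian hΓ₁.linear_part hN hKc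
    hKS hη₁.smooth.continuousOn hcusp₁ hs₁ hg₁
  -- The diameter of a ball of radius `ρ`, plus `1` for strictness.
  refine ⟨2 * ρ + 1, ?_⟩
  rintro Γ η hΓ hη ⟨s, hs, hg⟩ hcusp heq
  have hηη₁ : Set.EqOn η₁ η Margulis.SPlus :=
    Margulis.eqOn_of_eqOn_thick hN hη₁.smooth.continuousOn hη.smooth.continuousOn hcusp₁ hcusp
      (heq₁.trans heq.symm)
  -- Primitives of the same form differ by a constant `d`; translation by `d` carries the reference
  -- lines, and the ball they meet, to those of `Γ`.
  obtain ⟨d, hd⟩ := Margulis.isOpen_SPlus.exists_eq_add_of_fderiv_eq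
    (convex_ball _ _).isPreconnected
    (fun p hp => (hs p hp).differentiableAt.differentiableWithinAt)
    (fun p hp => (hs₁ p hp).differentiableAt.differentiableWithinAt)
    (fun p hp => by rw [(hs p hp).fderiv, (hs₁ p hp).fderiv, hηη₁ hp])
  refine ⟨Metric.closedBall d ρ, Metric.isBounded_closedBall,
    (Metric.diam_closedBall hρ).trans_lt (by linarith), ?_⟩
  rintro g ⟨hgΓ, hhyp, l, hl, hgl, hlK⟩
  have hgmem : g.linear ∈ Γ₀ := hΓ.linear_part ▸ Subgroup.mem_map_of_mem _ hgΓ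
  rw [← hΓ₁.linear_part] at hgmem
  obtain ⟨g₁, hg₁Γ, hlin⟩ := hgmem
  have hlin' : g₁.linear = g.linear := hlin
  obtain ⟨l₁, hl₁, hgl₁, x, hxl, hxρ⟩ := hlines g₁
    ⟨hg₁Γ, by rw [hlin']; exact hhyp, l, hl, by rw [hlin']; exact hgl, hlK⟩
  have h0 : (0 : Margulis.Plane) ∈ Margulis.SPlus := Metric.mem_ball_self one_pos
  have hact : Margulis.act g.linear 0 ∈ Margulis.SPlus := by
    have hAt := hΓ.fuchsian.futureTimelike
      (hΓ.linear_part ▸ Subgroup.mem_map_of_mem _ hgΓ : g.linear ∈ Γ₀)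
      (Margulis.futureTimelike_lift h0)
    exact Margulis.proj_mem_SPlus hAt
  have hconj : g (s₁ 0 + d) = g₁ (s₁ 0) + d := by
    have e1 := hg g hgΓ 0 h0
    have e2 := hg₁ g₁ hg₁Γ 0 h0
    have e3 : s 0 = s₁ 0 + d := hd h0
    have e4 : s (Margulis.act g.linear 0) = s₁ (Margulis.act g.linear 0) + d := hd hact
    rw [← e3, ← e1, e4, ← e2, hlin']
  refine ⟨(· + d) '' l₁, hl₁.image_add_const d,
    Margulis.image_add_const_of_semiconj hlin'.symm hconj hgl₁, x + d, ⟨x, hxl, rfl⟩, ?_⟩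
  rw [mem_closedBall_iff_norm, add_sub_cancel_right]
  exact mem_closedBall_zero_iff.1 hxρ
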